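/- **Theorem (Not every outerplanar graph admits an outerplanar L-drawing).** An *L-drawing* of a digraph represents the vertices by points of the plane with pairwise distinct $x$-coordinates and pairwise distinct $y$-coordinates, and each directed edge $(u,v)$ by the polyline consisting of a vertical segment incident to the tail $u$ followed by a horizontal segment incident to the head $v$. Two edges may overlap in a segment that has a common tail or a common head as an end point. The drawing is *planar* if no two edges cross, i.e. any two distinct edges have no common points other than common end vertices and such overlaps. A planar L-drawing induces an embedding (cyclic order of the edges around each vertex, where edges leaving a vertex on the same port and thus overlapping are regarded as consecutive edges forming an angle of $0^\circ$, and an outer face); the drawing is *outerplanar* if in this embedding every vertex is incident to the outer face. An *outerplanar embedding* of a connected graph is a planar rotation system with a chosen outer face that is incident to every vertex. A vertex is *4-modal* if in the cyclic order of its edges there are exactly four pairs of consecutive edges that are neither both incoming nor both outgoing. There is a finite connected digraph $G$ without loops and 2-cycles such that 1. $G$ (its underlying graph) has an outerplanar embedding, and this embedding is unique up to reflection; 2. this embedding has an inner face $f$ of degree $6$ such that every vertex incident to $f$ is 4-modal and is a source switch or a sink switch of $f$ (i.e. the two edges of $f$ meeting at that vertex are both outgoing or both incoming); 3. $G$ admits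 no outerplanar L-drawing. -/

import Mathlib

open Filter Topology

section Embeddings

variable {V : Type*}

/-- A rotation system of a simple graph: a permutation of the darts (oriented edges) that
permutes, for every vertex `v`, the darts starting at `v` in one single cycle. -/
structure RotationSystem (H : SimpleGraph V) where
  rot : Equiv.Perm H.Dart
  rot_fst : ∀ d, (rot d).fst = d.fst
  rot_sameCycle : ∀ d d', d.fst = d'.fst → rot.SameCycle d d'

namespace RotationSystem

variable {H : SimpleGraph V} (R : RotationSystem H)

/-- The face permutation: walk along a dart and continue with the successor, in the rotation at
its end, of the reversed dart. -/
def facePerm : Equiv.Perm H.Dart :=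
  (SimpleGraph.Dart.symm_involutive.toPerm SimpleGraph.Dart.symm).trans R.rot

/-- The faces: the orbits of the face permutation, as sets of darts. The degree of a face is its
number of elements. -/
def faces : Set (Set H.Dart) :=
  Set.range fun d => {d' | R.facePerm.SameCycle d d'}

/-- A rotation system of a finite connected graph with at least one edge is planar if it
satisfies Euler's formula `|V| - |E| + |F| = 2`. -/
def IsPlanar : Prop :=
  H.Connected ∧ Nat.card V + R.faces.ncard = Nat.card H.edgeSet + 2

end RotationSystem

/-- An outerplanar embedding of a (finite, connected) graph: a planar rotation system together
with the choice of an outer face that is incident to every vertex. -/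
structure OuterplanarEmbedding (H : SimpleGraph V) extends RotationSystem H where
  planar : toRotationSystem.IsPlanar
  outer : Set H.Dart
  outer_mem : outer ∈ toRotationSystem.faces
  outer_spanning : ∀ v : V, ∃ d ∈ outer, d.fst = v

/-- Two outerplanar embeddings coincide or are mirror images of each other. Reflection reverses
all rotations and the direction in which each face is traversed. -/
def OuterplanarEmbedding.EqUpToReflection {H : SimpleGraph V}
    (E E' : OuterplanarEmbedding H) : Prop :=
  (E'.rot = E.rot ∧ E'.outer = E.outer) ∨
    (E'.rot = E.rot⁻¹ ∧ E'.outer = SimpleGraph.Dart.symm '' E.outer)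

/-- The dart `d` of the underlying graph is an outgoing edge of the vertex where it starts
(otherwise it is an incoming edge of that vertex). -/
def IsOutgoing (G : Digraph V) (d : G.toSimpleGraphInclusive.Dart) : Prop :=
  G.Adj d.fst d.snd

namespace RotationSystem

variable {G : Digraph V} (R : RotationSystem G.toSimpleGraphInclusive)

/-- `mod(v)`: the number of pairs of edges that are consecutive around `v` and neither both
incoming nor both outgoing. (For a digraph without 2-cycles.) -/
noncomputable def modality (v : V) : ℕ :=
  {d : G.toSimpleGraphInclusive.Dart |
    d.fst = v ∧ ¬ (IsOutgoing G d ↔ IsOutgoing G (R.rot d))}.ncard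

/-- The corner of a face at the end of its dart `d` is a switch: the two edges of the face that
meet there are both outgoing (source switch) or both incoming (sink switch). -/
def IsSwitch (d : G.toSimpleGraphInclusive.Dart) : Prop :=
  IsOutgoing G d.symm ↔ IsOutgoing G (R.facePerm d)

end RotationSystem

end Embeddings

/-- An L-drawing: pairwise distinct x-coordinates and pairwise distinct y-coordinates for the
vertices. The polylines of the edges are determined by these, see `LDrawing.edge`. -/
structure LDrawing (V : Type*) where
  x : V → ℝ
  y : V → ℝ
  x_injective : Function.Injective x
  y_injective : Function.Injective y

namespace LDrawing

variable {V : Type*} (Γ : LDrawing V) (G : Digraph V)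

/-- The point representing the vertex `v`. -/
def pos (v : V) : ℝ × ℝ := (Γ.x v, Γ.y v)

/-- The bend of the edge from `u` to `v`. -/
def bend (u v : V) : ℝ × ℝ := (Γ.x u, Γ.y v)

/-- The vertical segment of the edge from `u` to `v`, incident to the tail `u`. -/
def vertical (u v : V) : Set (ℝ × ℝ) := segment ℝ (Γ.pos u) (Γ.bend u v)

/-- The horizontal segment of the edge from `u` to `v`, incident to the head `v`. -/
def horizontal (u v : V) : Set (ℝ × ℝ) := segment ℝ (Γ.bend u v) (Γ.pos v)

/-- The polyline of the edge from `u` to `v`. -/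
def edge (u v : V) : Set (ℝ × ℝ) := Γ.vertical u v ∪ Γ.horizontal u v

/-- All points covered by the drawing of `G`. -/
def image : Set (ℝ × ℝ) := Set.range Γ.pos ∪ ⋃ (u) (v) (_ : G.Adj u v), Γ.edge u v

/-- No two edges cross: every common point of two distinct edges is a common end vertex, or lies
on the overlap of their segments at a common tail or at a common head. -/
def IsPlanar : Prop :=
  ∀ u v u' v', G.Adj u v → G.Adj u' v' → (u, v) ≠ (u', v') →
    ∀ p ∈ Γ.edge u v ∩ Γ.edge u' v',
      (u = u' ∧ p ∈ Γ.vertical u v ∩ Γ.vertical u' v') ∨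
      (v = v' ∧ p ∈ Γ.horizontal u v ∩ Γ.horizontal u' v') ∨
      ∃ w, (w = u ∨ w = v) ∧ (w = u' ∨ w = v') ∧ p = Γ.pos w

/-- The outer face as a region of the plane: the points off the drawing whose connected component
in the complement of the drawing is unbounded. -/
def outerRegion : Set (ℝ × ℝ) :=
  {p | p ∈ (Γ.image G)ᶜ ∧ ¬ Bornology.IsBounded (connectedComponentIn (Γ.image G)ᶜ p)}

/-- The vertex `v` is incident to the outer face in the embedding induced by a planar L-drawing.
Either the outer region reaches the point of `v` itself, or `v` has an angle of zero degrees in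
the outer face. Such an angle is formed by two consecutive edges on the same port of `v`; they
overlap from `v` up to the bend of the shorter one and separate there, so the angle belongs to
the face that, at this bend, fills the corner between the perpendicular segment of the shorter
edge and the continuation of the longer one. Every edge that is not the longest one on its port
gives exactly one such angle. -/
def OnOuterFace (v : V) : Prop :=
  Γ.pos v ∈ closure (Γ.outerRegion G) ∨
  -- two outgoing edges on the same (North or South) port, the one to `w` being the shorter
  (∃ w w', G.Adj v w ∧ G.Adj v w' ∧
    ((Γ.y v < Γ.y w ∧ Γ.y w < Γ.y w') ∨ (Γ.y w' < Γ.y w ∧ Γ.y w < Γ.y v)) ∧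
    ∀ᶠ ε : ℝ in 𝓝[>] 0,
      (Γ.x v + ε * (Γ.x w - Γ.x v), Γ.y w + ε * (Γ.y w - Γ.y v)) ∈ Γ.outerRegion G) ∨
  -- two incoming edges on the same (East or West) port, the one from `u` being the shorter
  (∃ u u', G.Adj u v ∧ G.Adj u' v ∧
    ((Γ.x v < Γ.x u ∧ Γ.x u < Γ.x u') ∨ (Γ.x u' < Γ.x u ∧ Γ.x u < Γ.x v)) ∧
    ∀ᶠ ε : ℝ in 𝓝[>] 0,
      (Γ.x u + ε * (Γ.x u - Γ.x v), Γ.y v + ε * (Γ.y u - Γ.y v)) ∈ Γ.outerRegion G)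

/-- An outerplanar L-drawing of `G`: a planar one with every vertex incident to the outer face. -/
def IsOuterplanar : Prop :=
  Γ.IsPlanar G ∧ ∀ v, Γ.OnOuterFace G v

end LDrawing

/-! The witness is a hexagon of alternating sources and sinks, with a directed triangle on each edge
and a pendant edge at each vertex. A closed curve in a drawing is encoded as an integral
circulation, with negative weight on arcs traversed backwards. Its winding number around a point is
then a finite sum that depends only on the order of the coordinates. It vanishes on the outer
region, hence at every leaf off the curve, since a leaf has no angle of zero degrees. Walking along
pendant edges extends this to all vertices off the curve (`OuterLayout.extend`).

Suppose that the two hexagon edges at a vertex used opposite ports. The triangle edges would have to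
lie on the side away from the interior of the hexagon, and the pendant edge, sharing a port with one
hexagon edge, would run into the hexagon or into a triangle. So the two edges share a port
(`Corner.same_port`), and the hexagon winds around none of the four quadrants at the vertex
(`Corner.nearZero`). Consequently, if the edge from a source `s` to a sink `a` is the shorter one at
`s`, it is the longer one at `a`, and the other source joined to `a` uses the opposite port
(`OuterLayout.opposite`). Through its shorter edge each of the three sources thus selects another
source with opposite port. Either the selection is cyclic and two ports cannot be assigned to three
sources, or two sources select each other and each has the longer edge at their common sink.

Uniqueness of the embedding is a discharging argument. Euler's formula gives seven inner faces, each
of weight at least 6, and the outer face has weight at least 30. The total is 72, so all bounds are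
tight (`sum_weight_eq`). This makes inner faces through an apex triangles, and the face permutation
is then forced by the side on which one triangle lies. -/

/-! ### Winding numbers of circulations, and their behaviour along an arc -/

section Winding

variable {V : Type*}

/-- The indicator function of the vertices whose coordinate exceeds `a`. -/
noncomputable def rightOf (f : V → ℝ) (a : ℝ) (u : V) : ℤ := if a < f u then 1 else 0

/-- The indicator function of the vertices whose coordinate is at least `a`. -/
noncomputable def weakRightOf (f : V → ℝ) (a : ℝ) (u : V) : ℤ := if a ≤ f u then 1 else 0

/-- For `a = f z`, the strict and the weak indicator describe a point just beyond and just before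
`z`; a reflection exchanges the two. -/
lemma rightOf_neg (f : V → ℝ) (a : ℝ) :
    rightOf (fun u => -f u) (-a) = fun u => 1 - weakRightOf f a u := by
  funext u
  unfold rightOf weakRightOf
  split_ifs <;> first | rfl | (exfalso; linarith)

lemma weakRightOf_neg (f : V → ℝ) (a : ℝ) :
    weakRightOf (fun u => -f u) (-a) = fun u => 1 - rightOf f a u := by
  funext u
  unfold rightOf weakRightOf
  split_ifs <;> first | rfl | (exfalso; linarith)

lemma rightOf_ne {f : V → ℝ} {a b : ℝ} {u v : V} (h : rightOf f a u ≠ rightOf f b v) :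
    (a < f u ∧ f v ≤ b) ∨ (f u ≤ a ∧ b < f v) := by
  unfold rightOf at h
  split_ifs at h <;> simp_all

lemma weakRightOf_ne {f : V → ℝ} {a b : ℝ} {u v : V}
    (h : weakRightOf f a u ≠ weakRightOf f b v) :
    (a ≤ f u ∧ f v < b) ∨ (f u < a ∧ b ≤ f v) := by
  unfold weakRightOf at h
  split_ifs at h <;> simp_all

lemma weakRightOf_ne_rightOf {f : V → ℝ} {a b : ℝ} {u v : V}
    (h : weakRightOf f a u ≠ rightOf f b v) :
    (a ≤ f u ∧ f v ≤ b) ∨ (f u < a ∧ b < f v) := by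
  unfold weakRightOf rightOf at h
  split_ifs at h <;> simp_all

variable [Fintype V]

/-- The winding number of the weighted edges `c` of an L-drawing around a point, where `X` and `Y`
are the indicators of the vertices to the right of and above the point. -/
def winding (c : V → V → ℤ) (X Y : V → ℤ) : ℤ := ∑ u, ∑ v, c u v * X u * (Y v - Y u)

/-- An integral circulation on the arcs of `A`. -/
structure IsCirculation (A : V → V → Prop) (c : V → V → ℤ) : Prop where
  adj : ∀ u v, c u v ≠ 0 → A u v
  conserved : ∀ z, ∑ u, c u z = ∑ v, c z v

lemma IsCirculation.swap {A : V → V → Prop} {c : V → V → ℤ} (hc : IsCirculation A c) :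
    IsCirculation (fun u v => A v u) (fun u v => c v u) :=
  ⟨fun u v h => hc.adj v u h, fun z => (hc.conserved z).symm⟩

namespace IsCirculation

variable {A : V → V → Prop} {c : V → V → ℤ} (hc : IsCirculation A c)
include hc

/-- The definition counts vertical segments met by a ray to the right; this form counts horizontal
segments met by a ray upwards. The difference telescopes because inflow equals outflow at every
vertex. -/
lemma winding_eq (X Y : V → ℤ) :
    winding c X Y = ∑ u, ∑ v, c u v * (X u - X v) * Y v := by
  have h1 : ∑ u, ∑ v, c u v * (X u * Y u) = ∑ u, ∑ v, c u v * (X v * Y v) := by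
    rw [Finset.sum_comm (f := fun u v => c u v * (X v * Y v))]
    refine Finset.sum_congr rfl fun u _ => ?_
    rw [← Finset.sum_mul, ← Finset.sum_mul, hc.conserved]
  have h2 : winding c X Y - ∑ u, ∑ v, c u v * (X u - X v) * Y v
      = ∑ u, ∑ v, c u v * (X v * Y v) - ∑ u, ∑ v, c u v * (X u * Y u) := by
    simp only [winding, ← Finset.sum_sub_distrib]
    refine Finset.sum_congr rfl fun u _ => Finset.sum_congr rfl fun v _ => ?_
    ring
  rw [h1, sub_self] at h2
  linarith

lemma eq_zero_of_unique {z : V} (h : ∀ u, ¬ A u z) (h' : ∀ v w, A z v → A z w → v = w) (v : V) :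
    c z v = 0 := by
  by_contra h0
  have h1 := hc.conserved z
  rw [Finset.sum_eq_zero fun u _ => by_contra fun hu => h u (hc.adj u z hu),
    Finset.sum_eq_single v (fun w _ hw => by_contra fun hw' =>
      hw (h' w v (hc.adj z w hw') (hc.adj z v h0))) (by simp)] at h1
  exact h0 h1.symm

lemma winding_swap (X Y : V → ℤ) : winding (fun u v => c v u) Y X = winding c X Y := by
  rw [hc.winding_eq]
  unfold winding
  rw [Finset.sum_comm]
  refine Finset.sum_congr rfl fun u _ => Finset.sum_congr rfl fun v _ => ?_
  ring

lemma winding_one_sub_left (X Y : V → ℤ) :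
    winding c (fun u => 1 - X u) Y = -winding c X Y := by
  rw [hc.winding_eq, hc.winding_eq, ← Finset.sum_neg_distrib]
  refine Finset.sum_congr rfl fun u _ => ?_
  rw [← Finset.sum_neg_distrib]
  refine Finset.sum_congr rfl fun v _ => ?_
  ring

omit hc in
lemma winding_one_sub_right (c : V → V → ℤ) (X Y : V → ℤ) :
    winding c X (fun u => 1 - Y u) = -winding c X Y := by
  unfold winding
  rw [← Finset.sum_neg_distrib]
  refine Finset.sum_congr rfl fun u _ => ?_
  rw [← Finset.sum_neg_distrib]
  refine Finset.sum_congr rfl fun v _ => ?_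
  ring

-- Crossing the vertical line through `z` meets only the vertical segments of arcs leaving `z`, as
-- no other vertex has the same x-coordinate.
omit hc in
lemma winding_rightOf_left (c : V → V → ℤ) {x : V → ℝ} (hx : Function.Injective x) (z : V)
    (Y : V → ℤ) :
    winding c (rightOf x (x z)) Y =
      winding c (weakRightOf x (x z)) Y - ∑ v, c z v * (Y v - Y z) := by
  classical
  unfold winding
  rw [eq_sub_iff_add_eq, ← Finset.sum_erase_add _ _ (Finset.mem_univ z),
    ← Finset.sum_erase_add (a := z) Finset.univ
      (fun u => ∑ v, c u v * weakRightOf x (x z) u * (Y v - Y u)) (Finset.mem_univ z)]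
  have h1 : rightOf x (x z) z = 0 := by simp [rightOf]
  have h2 : weakRightOf x (x z) z = 1 := by simp [weakRightOf]
  simp only [h1, h2, mul_zero, zero_mul, Finset.sum_const_zero, add_zero, mul_one]
  congr 1
  refine Finset.sum_congr rfl fun u hu => Finset.sum_congr rfl fun v _ => ?_
  have : rightOf x (x z) u = weakRightOf x (x z) u := by
    by_contra h
    refine Finset.ne_of_mem_erase hu (hx ?_)
    rcases weakRightOf_ne_rightOf (Ne.symm h) with h | h <;> linarith
  rw [this]

lemma winding_rightOf_right {y : V → ℝ} (hy : Function.Injective y) (z : V) (X : V → ℤ) :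
    winding c X (rightOf y (y z)) =
      winding c X (weakRightOf y (y z)) - ∑ u, c u z * (X u - X z) := by
  rw [← hc.winding_swap, ← hc.winding_swap]
  exact winding_rightOf_left _ hy z X

-- A horizontal move of the point changes the winding number only if it passes a vertical segment
-- that spans its height. The next lemma but one is the analogue for vertical moves.
omit hc in
lemma winding_congr_left {c : V → V → ℤ} {X X' Y : V → ℤ}
    (h : ∀ u v, c u v ≠ 0 → X u ≠ X' u → Y u ≠ Y v → False) :
    winding c X Y = winding c X' Y := by
  unfold winding
  refine Finset.sum_congr rfl fun u _ => Finset.sum_congr rfl fun v _ => ?_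
  by_cases h0 : c u v = 0
  · simp [h0]
  by_cases h1 : X u = X' u
  · rw [h1]
  by_cases h2 : Y u = Y v
  · simp [h2]
  exact (h u v h0 h1 h2).elim

lemma winding_congr_right {X Y Y' : V → ℤ}
    (h : ∀ u v, c u v ≠ 0 → X u ≠ X v → Y v ≠ Y' v → False) :
    winding c X Y = winding c X Y' := by
  rw [hc.winding_eq, hc.winding_eq]
  refine Finset.sum_congr rfl fun u _ => Finset.sum_congr rfl fun v _ => ?_
  by_cases h0 : c u v = 0
  · simp [h0]
  by_cases h1 : X u = X v
  · simp [h1]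
  by_cases h2 : Y v = Y' v
  · rw [h2]
  exact (h u v h0 h1 h2).elim

end IsCirculation

open IsCirculation

/-- The order-theoretic content of a planar L-drawing in which the vertices of `Z` are incident to
the outer face: a vertical and a horizontal segment of two edges meet only where this is allowed,
and no closed curve in the drawing winds around a vertex of `Z` off that curve. -/
structure OuterLayout (A : V → V → Prop) (Z : Set V) (x y : V → ℝ) : Prop where
  irrefl : ∀ v, ¬ A v v
  x_inj : Function.Injective x
  y_inj : Function.Injective y
  cross : ∀ u v u' v', A u v → A u' v' → u ≠ u' → v ≠ v' → u ≠ v' →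
    x u ∈ Set.uIcc (x u') (x v') → y v' ∈ Set.uIcc (y u) (y v) → False
  outer : ∀ c, IsCirculation A c → ∀ z ∈ Z, (∀ v, c z v = 0) → (∀ v, c v z = 0) →
    winding c (rightOf x (x z)) (rightOf y (y z)) = 0

namespace OuterLayout

variable {A : V → V → Prop} {Z : Set V} {x y : V → ℝ} (L : OuterLayout A Z x y)
include L

lemma flipX : OuterLayout A Z (fun u => -x u) y where
  irrefl := L.irrefl
  x_inj u v h := L.x_inj (neg_injective h)
  y_inj := L.y_inj
  cross u v u' v' h h' h1 h2 h3 h4 h5 := by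
    refine L.cross u v u' v' h h' h1 h2 h3 ?_ h5
    rw [Set.mem_uIcc] at h4 ⊢
    rcases h4 with h4 | h4
    · exact Or.inr ⟨by linarith, by linarith⟩
    · exact Or.inl ⟨by linarith, by linarith⟩
  outer c hc z hz h1 h2 := by
    rw [rightOf_neg, hc.winding_one_sub_left, neg_eq_zero, ← L.outer c hc z hz h1 h2]
    -- The strict indicator has become weak, but the two differ only at `z`, which is off the curve.
    refine winding_congr_left fun u v h0 h3 _ => ?_
    obtain rfl : u = z := by
      apply L.x_inj
      rcases weakRightOf_ne_rightOf h3 with h | h <;> linarith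
    exact h0 (h1 v)

lemma flipY : OuterLayout A Z x (fun u => -y u) where
  irrefl := L.irrefl
  x_inj := L.x_inj
  y_inj u v h := L.y_inj (neg_injective h)
  cross u v u' v' h h' h1 h2 h3 h4 h5 := by
    refine L.cross u v u' v' h h' h1 h2 h3 h4 ?_
    rw [Set.mem_uIcc] at h5 ⊢
    rcases h5 with h5 | h5
    · exact Or.inr ⟨by linarith, by linarith⟩
    · exact Or.inl ⟨by linarith, by linarith⟩
  outer c hc z hz h1 h2 := by
    rw [rightOf_neg, winding_one_sub_right, neg_eq_zero, ← L.outer c hc z hz h1 h2]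
    refine hc.winding_congr_right fun u v h0 _ h3 => ?_
    obtain rfl : v = z := by
      apply L.y_inj
      rcases weakRightOf_ne_rightOf h3 with h | h <;> linarith
    exact h0 (h2 u)

lemma swap : OuterLayout (fun u v => A v u) Z y x where
  irrefl := L.irrefl
  x_inj := L.y_inj
  y_inj := L.x_inj
  cross u v u' v' h h' h1 h2 h3 h4 h5 := by
    refine L.cross v' u' v u h' h h2.symm h1.symm h3.symm ?_ ?_
    · rwa [Set.uIcc_comm]
    · rwa [Set.uIcc_comm]
  outer c hc z hz h1 h2 := by
    have := L.outer _ hc.swap z hz h2 h1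
    rwa [← hc.swap.winding_swap] at this

lemma y_ne {u v : V} (h : A u v) : y u ≠ y v := fun e =>
  L.irrefl v (by rwa [L.y_inj e] at h)

/-- Walking along an arc that leaves `s` upwards, the winding number stays constant as long as the
arcs of the curve that share its port branch off to the right. -/
lemma winding_arc {s p : V} (hsp : A s p) (hy : y s < y p) {c : V → V → ℤ}
    (hc : IsCirculation A c) (hp : ∀ v, c p v = 0) (hp' : ∀ v, c v p = 0)
    (h1 : ∀ v, c s v ≠ 0 → y s < y v → y v < y p → x s < x v)
    (h2 : x s < x p → ∀ v, c s v ≠ 0 → y v < y p) :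
    winding c (weakRightOf x (x s)) (rightOf y (y s)) =
      winding c (rightOf x (x p)) (rightOf y (y p)) := by
  have hne : ∀ u v, c u v ≠ 0 → u ≠ p ∧ v ≠ p := fun u v h =>
    ⟨fun e => h (e ▸ hp v), fun e => h (e ▸ hp' u)⟩
  trans winding c (weakRightOf x (x s)) (rightOf y (y p))
  -- First leg: up along the left side of the vertical segment, to just above the height of `p`.
  · refine hc.winding_congr_right fun u v h0 hX hY => ?_
    have hX := weakRightOf_ne hX
    have hY : y s < y v ∧ y v ≤ y p := by
      rcases rightOf_ne hY with h | h
      · exact h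
      · constructor <;> linarith
    have hvp : y v < y p := lt_of_le_of_ne hY.2 fun e => (hne u v h0).2 (L.y_inj e)
    have hsv : s ≠ v := by rintro rfl; exact lt_irrefl _ hY.1
    by_cases hsu : s = u
    · subst hsu
      have := h1 v h0 hY.1 hvp
      rcases hX with h | h <;> linarith
    · refine L.cross s p u v hsp (hc.adj _ _ h0) hsu (hne u v h0).2.symm hsv ?_ ?_
      · rw [Set.mem_uIcc]
        rcases hX with h | h
        · exact Or.inr ⟨h.2.le, h.1⟩
        · exact Or.inl ⟨h.1.le, h.2⟩
      · rw [Set.mem_uIcc]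
        exact Or.inl ⟨hY.1.le, hY.2⟩
  -- Second leg: along the upper side of the horizontal segment. If it turns right, it passes above
  -- the bend, where `h2` excludes a longer arc of the curve on the same port.
  · refine winding_congr_left fun u v h0 hX hY => ?_
    have hX := weakRightOf_ne_rightOf hX
    have hup : u ≠ p := (hne u v h0).1
    have hY := rightOf_ne hY
    have hus : u ≠ s := by
      rintro rfl
      have hx : x u < x p := by
        rcases hX with h | h
        · exact lt_of_le_of_ne h.2 fun e => hup (L.x_inj e)
        · exact absurd h.1 (lt_irrefl _)
      have := h2 hx v h0
      rcases hY with h | h <;> linarith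
    refine L.cross u v s p (hc.adj _ _ h0) hsp hus (hne u v h0).2 hup ?_ ?_
    · rw [Set.mem_uIcc]
      rcases hX with h | h
      · exact Or.inl h
      · exact Or.inr ⟨h.2.le, h.1.le⟩
    · rw [Set.mem_uIcc]
      rcases hY with h | h
      · exact Or.inr ⟨h.2, h.1.le⟩
      · exact Or.inl ⟨h.1, h.2.le⟩

end OuterLayout

/-- The winding number vanishes in all four quadrants next to `z`. -/
structure NearZero (c : V → V → ℤ) (x y : V → ℝ) (z : V) : Prop where
  ne : winding c (rightOf x (x z)) (rightOf y (y z)) = 0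
  nw : winding c (weakRightOf x (x z)) (rightOf y (y z)) = 0
  se : winding c (rightOf x (x z)) (weakRightOf y (y z)) = 0
  sw : winding c (weakRightOf x (x z)) (weakRightOf y (y z)) = 0

namespace NearZero

variable {A : V → V → Prop} {c : V → V → ℤ} {x y : V → ℝ} {z : V}

lemma flipX (hc : IsCirculation A c) (h : NearZero c x y z) :
    NearZero c (fun u => -x u) y z := by
  constructor <;> simp only [rightOf_neg, weakRightOf_neg, hc.winding_one_sub_left, neg_eq_zero]
  exacts [h.nw, h.ne, h.sw, h.se]

lemma flipY (h : NearZero c x y z) : NearZero c x (fun u => -y u) z := by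
  constructor <;> simp only [rightOf_neg, weakRightOf_neg, winding_one_sub_right, neg_eq_zero]
  exacts [h.se, h.sw, h.ne, h.nw]

lemma swap (hc : IsCirculation A c) (h : NearZero c x y z) :
    NearZero (fun u v => c v u) y x z := by
  constructor <;> rw [hc.winding_swap]
  exacts [h.ne, h.se, h.nw, h.sw]

lemma of_flipY (h : NearZero c x (fun u => -y u) z) : NearZero c x y z := by
  simpa using h.flipY

lemma of_swap (hc : IsCirculation A c) (h : NearZero (fun u v => c v u) y x z) :
    NearZero c x y z := h.swap hc.swap

end NearZero

end Winding

/-! ### Ports at the vertices of a cycle with triangles and pendant arcs -/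

section Corners

open IsCirculation

variable {V : Type*} [Fintype V]

namespace OuterLayout

variable {A : V → V → Prop} {Z : Set V} {x y : V → ℝ} (L : OuterLayout A Z x y)
include L

lemma winding_arc_right {s p : V} (hsp : A s p) (hy : y s < y p) {c : V → V → ℤ}
    (hc : IsCirculation A c) (hp : ∀ v, c p v = 0) (hp' : ∀ v, c v p = 0) (hpZ : p ∈ Z)
    (h1 : ∀ v, c s v ≠ 0 → y s < y v → y v < y p → x v < x s)
    (h2 : x p < x s → ∀ v, c s v ≠ 0 → y v < y p) :
    winding c (rightOf x (x s)) (rightOf y (y s)) = 0 := by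
  have := L.flipX.winding_arc hsp hy hc hp hp' (fun v h h' h'' => neg_lt_neg (h1 v h h' h''))
    (fun h => h2 (neg_lt_neg_iff.1 h))
  rw [L.flipX.outer c hc p hpZ hp hp', weakRightOf_neg, hc.winding_one_sub_left] at this
  exact neg_eq_zero.1 this

/-- The curve has no vertical segment at `s`, so both upper quadrants are joined to `p` along the
arc. Its horizontal segments at `s` all lie on one side; on the other side one can pass to the lower
quadrants. -/
lemma nearZero_of_arc_up {s p : V} (hsp : A s p) (hy : y s < y p) {c : V → V → ℤ}
    (hc : IsCirculation A c) (hp : ∀ v, c p v = 0) (hp' : ∀ v, c v p = 0) (hpZ : p ∈ Z)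
    (hs : ∀ v, c s v = 0)
    (hs' : (∀ u, c u s ≠ 0 → x u < x s) ∨ (∀ u, c u s ≠ 0 → x s < x u)) :
    NearZero c x y s := by
  have nw : winding c (weakRightOf x (x s)) (rightOf y (y s)) = 0 := by
    rw [L.winding_arc hsp hy hc hp hp' (fun v h => (h (hs v)).elim)
      (fun _ v h => (h (hs v)).elim)]
    exact L.outer c hc p hpZ hp hp'
  have ne : winding c (rightOf x (x s)) (rightOf y (y s)) = 0 :=
    L.winding_arc_right hsp hy hc hp hp' hpZ (fun v h => (h (hs v)).elim)
      (fun _ v h => (h (hs v)).elim)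
  have hx : ∀ Y, winding c (rightOf x (x s)) Y = winding c (weakRightOf x (x s)) Y := by
    intro Y
    simp [winding_rightOf_left c L.x_inj, hs]
  have hy : winding c (rightOf x (x s)) (weakRightOf y (y s)) = 0 := by
    rcases hs' with h | h
    · have := hc.winding_rightOf_right L.y_inj s (rightOf x (x s))
      rw [ne, Finset.sum_eq_zero, sub_zero] at this
      · exact this.symm
      · intro u _
        by_cases h0 : c u s = 0
        · simp [h0]
        · simp [rightOf, (h u h0).le]
    · rw [hx]
      have := hc.winding_rightOf_right L.y_inj s (weakRightOf x (x s))
      rw [nw, Finset.sum_eq_zero, sub_zero] at this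
      · exact this.symm
      · intro u _
        by_cases h0 : c u s = 0
        · simp [h0]
        · simp [weakRightOf, (h u h0).le]
  exact ⟨ne, nw, hy, (hx _).symm.trans hy⟩

lemma nearZero_of_arc {s p : V} (hsp : A s p) {c : V → V → ℤ}
    (hc : IsCirculation A c) (hp : ∀ v, c p v = 0) (hp' : ∀ v, c v p = 0) (hpZ : p ∈ Z)
    (hs : ∀ v, c s v = 0)
    (hs' : (∀ u, c u s ≠ 0 → x u < x s) ∨ (∀ u, c u s ≠ 0 → x s < x u)) :
    NearZero c x y s := by
  rcases lt_or_gt_of_ne (L.y_ne hsp) with h | h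
  · exact L.nearZero_of_arc_up hsp h hc hp hp' hpZ hs hs'
  · exact (L.flipY.nearZero_of_arc_up hsp (neg_lt_neg h) hc hp hp' hpZ hs hs').of_flipY

lemma winding_eq_zero_of_arc {s p : V} (hsp : A s p) {c : V → V → ℤ}
    (hc : IsCirculation A c) (hp : ∀ v, c p v = 0) (hp' : ∀ v, c v p = 0) (hpZ : p ∈ Z)
    (hs : ∀ v, c s v = 0) (hs' : ∀ v, c v s = 0) :
    winding c (rightOf x (x s)) (rightOf y (y s)) = 0 :=
  (L.nearZero_of_arc hsp hc hp hp' hpZ hs (Or.inl fun u h => (h (hs' u)).elim)).ne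

/-- If every vertex has a neighbour in `Z` that is on no closed curve, then no closed curve winds
around any vertex. -/
lemma extend (hZ : ∀ s, s ∈ Z ∨ ∃ p ∈ Z, (A s p ∨ A p s) ∧
      ∀ c, IsCirculation A c → (∀ v, c p v = 0) ∧ ∀ v, c v p = 0) :
    OuterLayout A Set.univ x y where
  irrefl := L.irrefl
  x_inj := L.x_inj
  y_inj := L.y_inj
  cross := L.cross
  outer c hc s _ hs hs' := by
    rcases hZ s with h | ⟨p, hp, h | h, h'⟩
    · exact L.outer c hc s h hs hs'
    · exact L.winding_eq_zero_of_arc h hc (h' c hc).1 (h' c hc).2 hp hs hs'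
    · have := L.swap.winding_eq_zero_of_arc h hc.swap (h' c hc).2 (h' c hc).1 hp hs' hs
      rwa [hc.winding_swap] at this

end OuterLayout

/-- The local structure of a digraph at a vertex `s` of a cycle `h` and of a triangle `k`: both
curves use the arc from `s` to `a`, the cycle continues with the arc from `s` to `b`, the triangle
with the arc from `t` to `s`, and there is a further arc from `s` to `p`. -/
structure Corner (A : V → V → Prop) (h k : V → V → ℤ) (s a b t p : V) : Prop where
  adj_a : A s a
  adj_b : A s b
  adj_t : A t s
  adj_p : A s p
  h_circ : IsCirculation A h
  k_circ : IsCirculation A k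
  h_out : ∀ v, h s v ≠ 0 → v = a ∨ v = b
  h_in : ∀ v, h v s = 0
  h_a : h s a ≠ 0
  h_t : ∀ v, h t v = 0
  h_t' : ∀ v, h v t = 0
  h_p : ∀ v, h p v = 0
  h_p' : ∀ v, h v p = 0
  k_out : ∀ v, k s v ≠ 0 → v = a
  k_in : ∀ v, k v s ≠ 0 → v = t
  k_t : k t s ≠ 0
  k_b : ∀ v, k b v = 0
  k_b' : ∀ v, k v b = 0
  k_p : ∀ v, k p v = 0
  k_p' : ∀ v, k v p = 0

namespace Corner

variable {A : V → V → Prop} {h k k' : V → V → ℤ} {s a b t t' p : V} {x y : V → ℝ}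

/-- With the interior of the cycle on the right, the triangle is forced to the left of the arc to
`a`. The arc to `p` leaves on the same port as that arc, and so enters one of the two regions. -/
lemma false_of_right (C : Corner A h k s a b t p) (L : OuterLayout A Set.univ x y)
    (hb : y b < y s) (ha : y s < y a) (hp : y s < y p)
    (hE : winding h (rightOf x (x s)) (rightOf y (y s)) ≠ 0) : False := by
  -- An arc entering from the right would join the north-east quadrant to `t`, around which the
  -- cycle does not wind.
  have ht : x t < x s := by
    refine lt_of_le_of_ne (not_lt.1 fun hlt => hE ?_) (L.swap.y_ne C.adj_t).symm
    rw [← C.h_circ.winding_swap]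
    exact L.swap.winding_arc_right (p := t) C.adj_t hlt C.h_circ.swap C.h_t' C.h_t trivial
      (fun v h => (h (C.h_in v)).elim) (fun _ v h => (h (C.h_in v)).elim)
  -- The triangle leaves `s` only upwards, so the arc to `b` joins the south-west quadrant to `b`.
  have sw : winding k (weakRightOf x (x s)) (weakRightOf y (y s)) = 0 := by
    have := L.flipY.winding_arc C.adj_b (neg_lt_neg hb) C.k_circ C.k_b C.k_b'
      (fun v hv h' => by
        rw [C.k_out v hv] at h'
        linarith)
      (fun _ v hv => by
        rw [C.k_out v hv]
        linarith)
    rw [L.flipY.outer k C.k_circ b trivial C.k_b C.k_b', rightOf_neg,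
      winding_one_sub_right] at this
    exact neg_eq_zero.1 this
  -- Between the two western quadrants only the arc from `t` is crossed.
  have nw : winding k (weakRightOf x (x s)) (rightOf y (y s)) ≠ 0 := by
    rw [C.k_circ.winding_rightOf_right L.y_inj s, sw, Finset.sum_eq_single t]
    · simp [weakRightOf, ht.not_ge, C.k_t]
    · intro u _ hu
      have : k u s = 0 := by
        by_contra h0
        exact hu (C.k_in u h0)
      simp [this]
    · simp
  have hpa : y p ≠ y a := fun e => C.h_a (L.y_inj e ▸ C.h_p' s)
  have hxp : x s ≠ x p := fun e => L.irrefl p (by have := C.adj_p; rwa [L.x_inj e] at this)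
  have hxa : x s ≠ x a := fun e => L.irrefl a (by have := C.adj_a; rwa [L.x_inj e] at this)
  -- `hW` says that the arc to `p` lies to the left of the arc to `a`, on the side of the triangle;
  -- otherwise it lies on the side of the cycle.
  by_cases hW : (y p < y a ∧ x p < x s) ∨ (y a < y p ∧ x s < x a)
  · apply nw
    rw [L.winding_arc C.adj_p hp C.k_circ C.k_p C.k_p']
    · exact L.outer k C.k_circ p trivial C.k_p C.k_p'
    · intro v hv _ h'
      obtain rfl := C.k_out v hv
      rcases hW with hW | hW
      · linarith
      · exact hW.2
    · intro hx v hv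
      obtain rfl := C.k_out v hv
      rcases hW with hW | hW
      · linarith
      · exact hW.1
  · push Not at hW
    apply hE
    refine L.winding_arc_right C.adj_p hp C.h_circ C.h_p C.h_p' trivial ?_ ?_
    · intro v hv h1 h2
      rcases C.h_out v hv with rfl | rfl
      · exact lt_of_le_of_ne (hW.2 h2) hxa.symm
      · linarith
    · intro hx v hv
      rcases C.h_out v hv with rfl | rfl
      · refine lt_of_le_of_ne (not_lt.1 fun hlt => ?_) hpa.symm
        have := hW.1 hlt
        linarith
      · linarith

/-- The winding numbers in the two upper quadrants differ by `h s a`, so one of them is nonzero; a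
reflection puts it on the right. -/
lemma false_of_up (C : Corner A h k s a b t p) (L : OuterLayout A Set.univ x y)
    (hb : y b < y s) (ha : y s < y a) (hp : y s < y p) : False := by
  by_cases hE : winding h (rightOf x (x s)) (rightOf y (y s)) = 0
  · refine C.false_of_right L.flipX hb ha hp ?_
    have := winding_rightOf_left h L.x_inj s (rightOf y (y s))
    rw [hE, Finset.sum_eq_single a] at this
    · rw [rightOf_neg, C.h_circ.winding_one_sub_left, neg_ne_zero]
      intro e
      rw [e] at this
      simp [rightOf, ha, C.h_a] at this
    · intro v _ hv
      by_cases h0 : h s v = 0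
      · simp [h0]
      · obtain rfl := (C.h_out v h0).resolve_left hv
        simp [rightOf, hb.le]
    · simp
  · exact C.false_of_right L hb ha hp hE

/-- The two arcs of the cycle leave `s` on the same port. -/
lemma same_port (C : Corner A h k s a b t p) (C' : Corner A h k' s b a t' p)
    (L : OuterLayout A Set.univ x y) :
    (y s < y a ∧ y s < y b) ∨ (y a < y s ∧ y b < y s) := by
  rcases lt_or_gt_of_ne (L.y_ne C.adj_a) with ha | ha <;>
  rcases lt_or_gt_of_ne (L.y_ne C.adj_b) with hb | hb
  · exact Or.inl ⟨ha, hb⟩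
  · exfalso
    rcases lt_or_gt_of_ne (L.y_ne C.adj_p) with hp | hp
    · exact C.false_of_up L hb ha hp
    -- The triangle to use is the one on the cycle edge that shares its port with the pendant arc.
    · exact C'.false_of_up L.flipY (neg_lt_neg ha) (neg_lt_neg hb) (neg_lt_neg hp)
  · exfalso
    rcases lt_or_gt_of_ne (L.y_ne C.adj_p) with hp | hp
    · exact C'.false_of_up L ha hb hp
    · exact C.false_of_up L.flipY (neg_lt_neg hb) (neg_lt_neg ha) (neg_lt_neg hp)
  · exact Or.inr ⟨ha, hb⟩

/-- Both arcs of the cycle are on one vertical port and `t` is off the cycle, so the arc from `t`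
leads all quadrants outside. -/
lemma nearZero (C : Corner A h k s a b t p) (C' : Corner A h k' s b a t' p)
    (L : OuterLayout A Set.univ x y) : NearZero h x y s := by
  refine NearZero.of_swap C.h_circ ?_
  refine L.swap.nearZero_of_arc (p := t) C.adj_t C.h_circ.swap C.h_t' C.h_t trivial C.h_in ?_
  rcases C.same_port C' L with hs | hs
  · right
    intro u hu
    rcases C.h_out u hu with rfl | rfl
    exacts [hs.1, hs.2]
  · left
    intro u hu
    rcases C.h_out u hu with rfl | rfl
    exacts [hs.1, hs.2]

end Corner

namespace OuterLayout

variable {A : V → V → Prop} {Z : Set V} {h : V → V → ℤ} {s a b s' : V} {x y : V → ℝ}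

/-- An arc that is the shorter one at its tail is the longer one at its head, and the ports at the
tails of the two arcs entering this head are opposite. -/
lemma opposite_of_lt (L : OuterLayout A Z x y) (hsb : A s b) (hsa : A s a) (hs'a : A s' a)
    (hc : IsCirculation A h) (h_out : ∀ v, h s v ≠ 0 → v = a ∨ v = b)
    (h_in : ∀ u, h u a ≠ 0 → u = s ∨ u = s')
    (h_a : h s a ≠ 0) (hss' : s ≠ s') (hsz : NearZero h x y s)
    (haz : NearZero h x y a) (hy : y s < y a) (hb : y a < y b) (hx : x s < x a)
    (hx' : x s' < x a) : y a < y s' ∧ x s < x s' := by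
  have hsa' : s ≠ a := by rintro rfl; exact lt_irrefl _ hx
  have hx'' : x s < x s' := by
    -- Otherwise the horizontal segment from `s'` would cross the vertical segment towards `b` at
    -- the height of `a`.
    refine lt_of_le_of_ne (not_lt.1 fun hlt => ?_) fun e => hss' (L.x_inj e)
    refine L.cross s b s' a hsb hs'a hss' ?_ hsa' ?_ ?_
    · rintro rfl
      exact lt_irrefl _ hb
    · exact Set.mem_uIcc.2 (Or.inl ⟨hlt.le, hx.le⟩)
    · exact Set.mem_uIcc.2 (Or.inl ⟨hy.le, hb.le⟩)
  refine ⟨lt_of_le_of_ne (not_lt.1 fun hlt => ?_) (L.y_ne hs'a).symm, hx''⟩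
  -- Assuming that `s'` is below `a`, the points just below and just above the horizontal segment of
  -- the arc from `s` to `a`, next to its bend, are compared. The lower one is reached from `s`, the
  -- upper one from `a`.
  have below : winding h (rightOf x (x s)) (weakRightOf y (y a)) = 0 := by
    rw [← hsz.ne]
    refine hc.winding_congr_right fun u v h0 hX hY => ?_
    have hY : y s < y v ∧ y v < y a := by
      rcases weakRightOf_ne_rightOf hY with h | h
      · exact absurd h.2 (not_le.2 (hy.trans_le h.1))
      · exact h.symm
    have hus : u ≠ s := by
      rintro rfl
      rcases h_out v h0 with rfl | rfl <;> linarith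
    refine L.cross s a u v hsa (hc.adj _ _ h0) hus.symm ?_ ?_ ?_ ?_
    · rintro rfl
      exact lt_irrefl _ hY.2
    · rintro rfl
      exact lt_irrefl _ hY.1
    · rw [Set.mem_uIcc]
      rcases rightOf_ne hX with h | h
      · exact Or.inr ⟨h.2, h.1.le⟩
      · exact Or.inl ⟨h.1, h.2.le⟩
    · exact Set.mem_uIcc.2 (Or.inl ⟨hY.1.le, hY.2.le⟩)
  have above : winding h (rightOf x (x s)) (rightOf y (y a)) = 0 := by
    rw [← haz.nw]
    refine (winding_congr_left fun u v h0 hX hY => ?_).symm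
    have hX : x s < x u ∧ x u < x a := by
      rcases weakRightOf_ne_rightOf hX with h | h
      · exact absurd h.2 (not_le.2 (hx.trans_le h.1))
      · exact h.symm
    have hY := rightOf_ne hY
    have hva : v ≠ a := by
      rintro rfl
      rcases h_in u h0 with rfl | rfl
      · exact lt_irrefl _ hX.1
      · rcases hY with h | h <;> linarith
    refine L.cross u v s a (hc.adj _ _ h0) hsa ?_ hva ?_ ?_ ?_
    · rintro rfl
      exact lt_irrefl _ hX.1
    · rintro rfl
      exact lt_irrefl _ hX.2
    · exact Set.mem_uIcc.2 (Or.inl ⟨hX.1.le, hX.2.le⟩)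
    · rw [Set.mem_uIcc]
      rcases hY with h | h
      · exact Or.inr ⟨h.2, h.1.le⟩
      · exact Or.inl ⟨h.1, h.2.le⟩
  -- The two points are separated by the arc from `s` alone, since the segment from `s'` begins
  -- further right; hence `h s a = 0`.
  have := hc.winding_rightOf_right L.y_inj a (rightOf x (x s))
  rw [above, below, Finset.sum_eq_single s] at this
  · simp only [rightOf, hx, if_true, lt_irrefl, if_false] at this
    exact h_a (by linarith)
  · intro u _ hu
    by_cases h0 : h u a = 0
    · simp [h0]
    · obtain rfl := (h_in u h0).resolve_left hu
      simp [rightOf, hx, hx'']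
  · simp

lemma opposite (L : OuterLayout A Z x y) (hsb : A s b) (hsa : A s a) (hs'a : A s' a)
    (hc : IsCirculation A h) (h_out : ∀ v, h s v ≠ 0 → v = a ∨ v = b)
    (h_in : ∀ u, h u a ≠ 0 → u = s ∨ u = s')
    (h_a : h s a ≠ 0) (hss' : s ≠ s') (hsz : NearZero h x y s)
    (haz : NearZero h x y a) (hy : (y s < y a ∧ y a < y b) ∨ (y a < y s ∧ y b < y a))
    (hx : (x s < x a ∧ x s' < x a) ∨ (x a < x s ∧ x a < x s')) :
    ((y s < y a ∧ y a < y s') ∨ (y a < y s ∧ y s' < y a)) ∧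
      ((x s < x s' ∧ x s' < x a) ∨ (x s' < x s ∧ x a < x s')) := by
  rcases hy with hy | hy <;> rcases hx with hx | hx
  · have := L.opposite_of_lt hsb hsa hs'a hc h_out h_in h_a hss' hsz haz hy.1 hy.2 hx.1 hx.2
    exact ⟨Or.inl ⟨hy.1, this.1⟩, Or.inl ⟨this.2, hx.2⟩⟩
  · have := L.flipX.opposite_of_lt hsb hsa hs'a hc h_out h_in h_a hss' (hsz.flipX hc)
      (haz.flipX hc) hy.1 hy.2 (neg_lt_neg hx.1) (neg_lt_neg hx.2)
    exact ⟨Or.inl ⟨hy.1, this.1⟩, Or.inr ⟨neg_lt_neg_iff.1 this.2, hx.2⟩⟩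
  · have := L.flipY.opposite_of_lt hsb hsa hs'a hc h_out h_in h_a hss' hsz.flipY
      haz.flipY (neg_lt_neg hy.1) (neg_lt_neg hy.2) hx.1 hx.2
    exact ⟨Or.inr ⟨hy.1, neg_lt_neg_iff.1 this.1⟩, Or.inl ⟨this.2, hx.2⟩⟩
  · have := L.flipY.flipX.opposite_of_lt hsb hsa hs'a hc h_out h_in h_a hss'
      (hsz.flipY.flipX hc) (haz.flipY.flipX hc) (neg_lt_neg hy.1) (neg_lt_neg hy.2)
      (neg_lt_neg hx.1) (neg_lt_neg hx.2)
    exact ⟨Or.inr ⟨hy.1, neg_lt_neg_iff.1 this.1⟩, Or.inr ⟨neg_lt_neg_iff.1 this.2, hx.2⟩⟩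

end OuterLayout

end Corners

/-! ### From outerplanar L-drawings to layouts -/

namespace LDrawing

variable {V : Type*} (Γ : LDrawing V) (G : Digraph V)

lemma mem_vertical {u v : V} {p : ℝ × ℝ} :
    p ∈ Γ.vertical u v ↔ p.1 = Γ.x u ∧ p.2 ∈ Set.uIcc (Γ.y u) (Γ.y v) := by
  unfold vertical pos bend
  rw [← Prod.image_mk_segment_right, segment_eq_uIcc]
  constructor
  · rintro ⟨t, ht, rfl⟩
    exact ⟨rfl, ht⟩
  · rintro ⟨h, h'⟩
    exact ⟨p.2, h', Prod.ext h.symm rfl⟩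

lemma mem_horizontal {u v : V} {p : ℝ × ℝ} :
    p ∈ Γ.horizontal u v ↔ p.2 = Γ.y v ∧ p.1 ∈ Set.uIcc (Γ.x u) (Γ.x v) := by
  unfold horizontal pos bend
  rw [← Prod.image_mk_segment_left, segment_eq_uIcc]
  constructor
  · rintro ⟨t, ht, rfl⟩
    exact ⟨rfl, ht⟩
  · rintro ⟨h, h'⟩
    exact ⟨p.1, h', Prod.ext rfl h.symm⟩

variable {Γ G}

lemma IsPlanar.not_cross (hΓ : Γ.IsPlanar G) {u v u' v' : V} (h : G.Adj u v)
    (h' : G.Adj u' v') (h1 : u ≠ u') (h2 : v ≠ v') (h3 : u ≠ v')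
    (hx : Γ.x u ∈ Set.uIcc (Γ.x u') (Γ.x v')) (hy : Γ.y v' ∈ Set.uIcc (Γ.y u) (Γ.y v)) :
    False := by
  rcases hΓ u v u' v' h h' (fun e => h1 (congrArg Prod.fst e)) (Γ.x u, Γ.y v')
    ⟨Or.inl (Γ.mem_vertical.2 ⟨rfl, hy⟩), Or.inr (Γ.mem_horizontal.2 ⟨rfl, hx⟩)⟩ with
    ⟨e, _⟩ | ⟨e, _⟩ | ⟨w, _, _, e⟩
  · exact h1 e
  · exact h2 e
  · exact h3 ((Γ.x_injective (congrArg Prod.fst e)).trans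
      (Γ.y_injective (congrArg Prod.snd e)).symm)

variable [Fintype V]

lemma eventually_rightOf_eq (f : V → ℝ) (a : ℝ) :
    ∀ᶠ q in 𝓝 a, ∀ u, rightOf f q u ≠ rightOf f a u → f u = a := by
  rw [eventually_all]
  intro u
  by_cases h : f u = a
  · exact Eventually.of_forall fun _ _ => h
  rcases lt_or_gt_of_ne h with h | h
  · filter_upwards [lt_mem_nhds h] with q hq h'
    refine (h' ?_).elim
    simp [rightOf, hq.le.not_gt, h.le.not_gt]
  · filter_upwards [gt_mem_nhds h] with q hq h'
    refine (h' ?_).elim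
    simp [rightOf, hq, h]

/-- The winding number is locally constant off the curve. -/
lemma eventually_winding_eq {c : V → V → ℤ} (hc : IsCirculation G.Adj c) {p : ℝ × ℝ}
    (hp : ∀ u v, c u v ≠ 0 → p ∉ Γ.edge u v) :
    ∀ᶠ q in 𝓝 p, winding c (rightOf Γ.x q.1) (rightOf Γ.y q.2) =
      winding c (rightOf Γ.x p.1) (rightOf Γ.y p.2) := by
  filter_upwards [continuous_fst.continuousAt.eventually (eventually_rightOf_eq Γ.x p.1),
    continuous_snd.continuousAt.eventually (eventually_rightOf_eq Γ.y p.2)] with q hx hy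
  trans winding c (rightOf Γ.x p.1) (rightOf Γ.y q.2)
  · refine IsCirculation.winding_congr_left fun u v h0 hX hY => ?_
    refine hp u v h0 (Or.inl (Γ.mem_vertical.2 ⟨(hx u hX).symm, ?_⟩))
    by_cases hu : Γ.y u = p.2
    · exact hu ▸ Set.left_mem_uIcc
    by_cases hv : Γ.y v = p.2
    · exact hv ▸ Set.right_mem_uIcc
    have hu' : rightOf Γ.y q.2 u = rightOf Γ.y p.2 u := by_contra fun h => hu (hy u h)
    have hv' : rightOf Γ.y q.2 v = rightOf Γ.y p.2 v := by_contra fun h => hv (hy v h)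
    rw [hu', hv'] at hY
    rw [Set.mem_uIcc]
    rcases rightOf_ne hY with h | h
    · exact Or.inr ⟨h.2, h.1.le⟩
    · exact Or.inl ⟨h.1, h.2.le⟩
  · refine hc.winding_congr_right fun u v h0 hX hY => ?_
    refine hp u v h0 (Or.inr (Γ.mem_horizontal.2 ⟨(hy v hY).symm, ?_⟩))
    rw [Set.mem_uIcc]
    rcases rightOf_ne hX with h | h
    · exact Or.inr ⟨h.2, h.1.le⟩
    · exact Or.inl ⟨h.1, h.2.le⟩

/-- The winding number vanishes far away from the drawing. -/
lemma exists_bounded_winding_eq_zero (Γ : LDrawing V) {c : V → V → ℤ}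
    (hc : IsCirculation G.Adj c) :
    ∃ B : Set (ℝ × ℝ), Bornology.IsBounded B ∧
      ∀ q ∉ B, winding c (rightOf Γ.x q.1) (rightOf Γ.y q.2) = 0 := by
  obtain ⟨a, ha⟩ := (Set.finite_range Γ.x).bddBelow
  obtain ⟨a', ha'⟩ := (Set.finite_range Γ.x).bddAbove
  obtain ⟨b, hb⟩ := (Set.finite_range Γ.y).bddBelow
  obtain ⟨b', hb'⟩ := (Set.finite_range Γ.y).bddAbove
  have ha u : a ≤ Γ.x u := ha ⟨u, rfl⟩
  have ha' u : Γ.x u ≤ a' := ha' ⟨u, rfl⟩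
  have hb u : b ≤ Γ.y u := hb ⟨u, rfl⟩
  have hb' u : Γ.y u ≤ b' := hb' ⟨u, rfl⟩
  refine ⟨Set.Icc a a' ×ˢ Set.Icc b b',
    (Metric.isBounded_Icc a a').prod (Metric.isBounded_Icc b b'), fun q hq => ?_⟩
  by_cases h : q.1 ∈ Set.Icc a a'
  · have h' : ∀ u v, rightOf Γ.y q.2 u = rightOf Γ.y q.2 v := by
      intro u v
      have hq' : ¬ (b ≤ q.2 ∧ q.2 ≤ b') := fun h' => hq ⟨h, h'⟩
      by_contra hne
      rcases rightOf_ne hne with h1 | h1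
      · exact hq' ⟨(hb v).trans h1.2, h1.1.le.trans (hb' u)⟩
      · exact hq' ⟨(hb u).trans h1.1, h1.2.le.trans (hb' v)⟩
    unfold winding
    simp [fun u v => sub_eq_zero.2 (h' u v)]
  · have h' : ∀ u v, rightOf Γ.x q.1 u = rightOf Γ.x q.1 v := by
      intro u v
      by_contra hne
      rcases rightOf_ne hne with h1 | h1
      · exact h ⟨(ha v).trans h1.2, h1.1.le.trans (ha' u)⟩
      · exact h ⟨(ha u).trans h1.1, h1.2.le.trans (ha' v)⟩
    rw [hc.winding_eq]
    simp [fun u v => sub_eq_zero.2 (h' u v)]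

/-- The winding number is constant on a component of the complement, and an unbounded component
reaches points where it vanishes. -/
lemma winding_eq_zero_of_mem_outerRegion {c : V → V → ℤ} (hc : IsCirculation G.Adj c)
    {p : ℝ × ℝ} (hp : p ∈ Γ.outerRegion G) :
    winding c (rightOf Γ.x p.1) (rightOf Γ.y p.2) = 0 := by
  obtain ⟨B, hB, hB0⟩ := exists_bounded_winding_eq_zero Γ hc
  obtain ⟨q, hq, hqB⟩ := Set.not_subset.1 fun h => hp.2 (hB.subset h)
  rw [← hB0 q hqB]
  refine isPreconnected_connectedComponentIn.constant
    (f := fun q : ℝ × ℝ => winding c (rightOf Γ.x q.1) (rightOf Γ.y q.2)) ?_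
    (mem_connectedComponentIn hp.1) hq
  intro r hr
  refine ContinuousAt.continuousWithinAt ?_
  rw [ContinuousAt, nhds_discrete ℤ, tendsto_pure]
  refine eventually_winding_eq hc fun u v h0 hmem => ?_
  refine connectedComponentIn_subset _ _ hr (Or.inr ?_)
  simp only [Set.mem_iUnion]
  exact ⟨u, v, hc.adj u v h0, hmem⟩

lemma winding_eq_zero_of_mem_closure {c : V → V → ℤ} (hc : IsCirculation G.Adj c)
    {p : ℝ × ℝ} (hp : p ∈ closure (Γ.outerRegion G)) (hp' : ∀ u v, c u v ≠ 0 → p ∉ Γ.edge u v) :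
    winding c (rightOf Γ.x p.1) (rightOf Γ.y p.2) = 0 := by
  obtain ⟨q, hq, hq'⟩ := ((mem_closure_iff_frequently.1 hp).and_eventually
    (eventually_winding_eq hc hp')).exists
  exact hq'.symm.trans (winding_eq_zero_of_mem_outerRegion hc hq)

-- Planarity constrains pairs of edges only, so an edge incident to `z` is needed to keep `z` off
-- the other edges.
omit [Fintype V] in
lemma IsPlanar.pos_notMem_edge (hΓ : Γ.IsPlanar G) {z w u v : V} (hz : G.Adj z w ∨ G.Adj w z)
    (huv : G.Adj u v) (hu : z ≠ u) (hv : z ≠ v) : Γ.pos z ∉ Γ.edge u v := by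
  intro h
  have key : ∀ u' v', G.Adj u' v' → (z = u' ∨ z = v') → Γ.pos z ∈ Γ.edge u' v' → False := by
    intro u' v' h' hz' hmem
    have hne : (u, v) ≠ (u', v') := by
      intro e
      rw [Prod.mk.injEq] at e
      rcases hz' with rfl | rfl
      · exact hu e.1.symm
      · exact hv e.2.symm
    rcases hΓ u v u' v' huv h' hne _ ⟨h, hmem⟩ with ⟨_, e⟩ | ⟨_, e⟩ | ⟨t, ht, _, e⟩
    · exact hu (Γ.x_injective (Γ.mem_vertical.1 e.1).1)
    · exact hv (Γ.y_injective (Γ.mem_horizontal.1 e.1).1)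
    · obtain rfl : z = t := Γ.x_injective (congrArg Prod.fst e)
      exact ht.elim hu hv
  rcases hz with hz | hz
  · exact key z w hz (Or.inl rfl) (Or.inl (Γ.mem_vertical.2 ⟨rfl, Set.left_mem_uIcc⟩))
  · exact key w z hz (Or.inr rfl) (Or.inr (Γ.mem_horizontal.2 ⟨rfl, Set.right_mem_uIcc⟩))

/-- An outerplanar L-drawing of a digraph without loops and isolated vertices. -/
lemma IsOuterplanar.outerLayout (hΓ : Γ.IsOuterplanar G) (hG : ∀ v, ¬ G.Adj v v)
    (hG' : ∀ z, ∃ w, G.Adj z w ∨ G.Adj w z) :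
    OuterLayout G.Adj {z | (∀ v w, G.Adj z v → G.Adj z w → v = w) ∧
      ∀ v w, G.Adj v z → G.Adj w z → v = w} Γ.x Γ.y where
  irrefl := hG
  x_inj := Γ.x_injective
  y_inj := Γ.y_injective
  cross u v u' v' := hΓ.1.not_cross
  outer c hc z hz hz1 hz2 := by
    obtain ⟨w, hw⟩ := hG' z
    rcases hΓ.2 z with h | ⟨v, w, hv, hw, hlt, -⟩ | ⟨v, w, hv, hw, hlt, -⟩
    · have hmem : ∀ u v, c u v ≠ 0 → Γ.pos z ∉ Γ.edge u v := by
        intro u v h0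
        refine hΓ.1.pos_notMem_edge hw (hc.adj u v h0) ?_ ?_
        · rintro rfl
          exact h0 (hz1 v)
        · rintro rfl
          exact h0 (hz2 u)
      have := winding_eq_zero_of_mem_closure hc h hmem
      exact this
    -- An angle of zero degrees needs two distinct out-neighbours or two distinct in-neighbours.
    · obtain rfl := hz.1 v w hv hw
      rcases hlt with h | h
      · exact absurd h.2 (lt_irrefl _)
      · exact absurd h.1 (lt_irrefl _)
    · obtain rfl := hz.2 v w hv hw
      rcases hlt with h | h
      · exact absurd h.2 (lt_irrefl _)
      · exact absurd h.1 (lt_irrefl _)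

end LDrawing

/-! ### The digraph, and why it has no outerplanar L-drawing -/

namespace Hexagon

/-- The arcs of a hexagon `0, …, 5` of alternating sources and sinks, of directed triangles on its
edges with the apices `6, …, 11`, and of pendant edges to the leaves `12, …, 17`. -/
def arcs : List (Fin 18 × Fin 18) :=
  [(0, 1), (0, 5), (2, 1), (2, 3), (4, 3), (4, 5),
    (1, 6), (6, 0), (1, 7), (7, 2), (3, 8), (8, 2), (3, 9), (9, 4), (5, 10), (10, 4), (5, 11), (11, 0),
    (0, 12), (13, 1), (2, 14), (15, 3), (4, 16), (17, 5)]

/-- The digraph with the arcs `Hexagon.arcs`. -/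
def digraph : Digraph (Fin 18) where
  Adj u v := (u, v) ∈ arcs

instance : DecidableRel digraph.Adj := fun u v => inferInstanceAs (Decidable ((u, v) ∈ arcs))

/-- The sources of the hexagon. -/
def source (j : Fin 3) : Fin 18 := ![0, 2, 4] j

/-- The sinks of the hexagon. -/
def sink (j : Fin 3) : Fin 18 := ![1, 3, 5] j

/-- The apex of the triangle on the edge from `source j` to `sink j`. -/
def apex (j : Fin 3) : Fin 18 := ![6, 8, 10] j

/-- The apex of the triangle on the edge from `source (j + 1)` to `sink j`. -/
def apex' (j : Fin 3) : Fin 18 := ![7, 9, 11] j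

/-- The leaf at `source j`. -/
def sourceLeaf (j : Fin 3) : Fin 18 := ![12, 14, 16] j

/-- The leaf at `sink j`. -/
def sinkLeaf (j : Fin 3) : Fin 18 := ![13, 15, 17] j

/-- The circulation around the hexagon. -/
def cycle (u v : Fin 18) : ℤ :=
  if (u, v) ∈ [((0 : Fin 18), (1 : Fin 18)), (2, 3), (4, 5)] then 1
  else if (u, v) ∈ [((0 : Fin 18), (5 : Fin 18)), (2, 1), (4, 3)] then -1 else 0

/-- The circulation around the triangle on the edge from `source j` to `sink j`. -/
def triangle (j : Fin 3) (u v : Fin 18) : ℤ :=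
  if (u, v) ∈ [(source j, sink j), (sink j, apex j), (apex j, source j)] then 1 else 0

/-- The circulation around the triangle on the edge from `source (j + 1)` to `sink j`. -/
def triangle' (j : Fin 3) (u v : Fin 18) : ℤ :=
  if (u, v) ∈ [(source (j + 1), sink j), (sink j, apex' j), (apex' j, source (j + 1))] then 1 else 0

lemma isCirculation_cycle : IsCirculation digraph.Adj cycle :=
  ⟨by decide +kernel, by decide +kernel⟩

lemma isCirculation_triangle (j : Fin 3) : IsCirculation digraph.Adj (triangle j) :=
  ⟨by revert j; decide +kernel, by revert j; decide +kernel⟩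

lemma isCirculation_triangle' (j : Fin 3) : IsCirculation digraph.Adj (triangle' j) :=
  ⟨by revert j; decide +kernel, by revert j; decide +kernel⟩

lemma corner_source (j : Fin 3) : Corner digraph.Adj cycle (triangle (j + 1))
    (source (j + 1)) (sink (j + 1)) (sink j) (apex (j + 1)) (sourceLeaf (j + 1)) := by
  constructor
  case h_circ => exact isCirculation_cycle
  case k_circ => exact isCirculation_triangle _
  all_goals revert j; decide +kernel

lemma corner_source' (j : Fin 3) : Corner digraph.Adj cycle (triangle' j)
    (source (j + 1)) (sink j) (sink (j + 1)) (apex' j) (sourceLeaf (j + 1)) := by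
  constructor
  case h_circ => exact isCirculation_cycle
  case k_circ => exact isCirculation_triangle' _
  all_goals revert j; decide +kernel

/-- Reversing all arcs and exchanging the coordinates turns sinks into sources. -/
lemma corner_sink (j : Fin 3) : Corner (fun u v => digraph.Adj v u) (fun u v => cycle v u)
    (fun u v => triangle j v u) (sink j) (source j) (source (j + 1)) (apex j) (sinkLeaf j) := by
  constructor
  case h_circ => exact isCirculation_cycle.swap
  case k_circ => exact (isCirculation_triangle _).swap
  all_goals revert j; decide +kernel

lemma corner_sink' (j : Fin 3) : Corner (fun u v => digraph.Adj v u) (fun u v => cycle v u)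
    (fun u v => triangle' j v u) (sink j) (source (j + 1)) (source j) (apex' j) (sinkLeaf j) := by
  constructor
  case h_circ => exact isCirculation_cycle.swap
  case k_circ => exact (isCirculation_triangle' _).swap
  all_goals revert j; decide +kernel

section NoLayout

variable {x y : Fin 18 → ℝ} (L : OuterLayout digraph.Adj Set.univ x y)
include L

lemma nearZero_source (j : Fin 3) : NearZero cycle x y (source (j + 1)) :=
  (corner_source j).nearZero (corner_source' j) L

lemma nearZero_sink (j : Fin 3) : NearZero cycle x y (sink j) :=
  ((corner_sink j).nearZero (corner_sink' j) L.swap).of_swap isCirculation_cycle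

/-- The ports at two sources next to each other in the hexagon are opposite if the edge of one of
them to their common sink is shorter than its other edge in the hexagon; and then it is the longer
one at the common sink. -/
lemma opposite_sources (j : Fin 3) :
    ((y (source (j + 1)) < y (sink (j + 1)) ↔ ¬ y (source (j + 1 + 1)) < y (sink (j + 1 + 1))) ∧
      ((x (source (j + 1)) < x (source (j + 1 + 1)) ∧ x (source (j + 1 + 1)) < x (sink (j + 1))) ∨
      (x (source (j + 1 + 1)) < x (source (j + 1)) ∧ x (sink (j + 1)) < x (source (j + 1 + 1))))) ∨
    ((y (source (j + 1)) < y (sink (j + 1)) ↔ ¬ y (source j) < y (sink j)) ∧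
      ((x (source (j + 1)) < x (source j) ∧ x (source j) < x (sink j)) ∨
      (x (source j) < x (source (j + 1)) ∧ x (sink j) < x (source j)))) := by
  have hsink : ∀ j, sink j ≠ sink (j + 1) := by decide
  have hsource : ∀ j, source j ≠ source (j + 1) := by decide
  have hne : y (sink j) ≠ y (sink (j + 1)) := fun e => hsink j (L.y_inj e)
  have hs := (corner_source j).same_port (corner_source' j) L
  have hcase : ((y (source (j + 1)) < y (sink (j + 1)) ∧ y (sink (j + 1)) < y (sink j)) ∨
      (y (sink (j + 1)) < y (source (j + 1)) ∧ y (sink j) < y (sink (j + 1)))) ∨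
      ((y (source (j + 1)) < y (sink j) ∧ y (sink j) < y (sink (j + 1))) ∨
      (y (sink j) < y (source (j + 1)) ∧ y (sink (j + 1)) < y (sink j))) := by
    rcases lt_or_gt_of_ne hne with hlt | hlt <;> tauto
  rcases hcase with hy | hy
  · left
    have := L.opposite (corner_source j).adj_b (corner_source j).adj_a
      (corner_sink (j + 1)).adj_b isCirculation_cycle (corner_source j).h_out
      (corner_sink (j + 1)).h_out (corner_source j).h_a (hsource _)
      (nearZero_source L j) (nearZero_sink L (j + 1)) hy
      ((corner_sink (j + 1)).same_port (corner_sink' (j + 1)) L.swap).symm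
    refine ⟨?_, this.2⟩
    have hs' := (corner_source (j + 1)).same_port (corner_source' (j + 1)) L
    constructor
    · intro h h'
      rcases this.1 with h1 | h1 <;> rcases hs' with h2 | h2 <;> linarith [h1.1, h1.2, h2.1, h2.2]
    · intro h
      rcases this.1 with h1 | h1
      · exact h1.1
      · rcases hs' with h2 | h2
        · exact absurd h2.1 h
        · linarith [h1.1, h1.2, h2.1, h2.2]
  · right
    have := L.opposite (corner_source j).adj_a (corner_source j).adj_b
      (corner_sink j).adj_a isCirculation_cycle (corner_source' j).h_out
      (corner_sink' j).h_out (corner_source' j).h_a (hsource _).symm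
      (nearZero_source L j) (nearZero_sink L j) hy
      ((corner_sink' j).same_port (corner_sink j) L.swap).symm
    refine ⟨?_, this.2⟩
    constructor
    · intro h h'
      rcases this.1 with h1 | h1 <;> rcases hs with h2 | h2 <;> linarith [h1.1, h1.2, h2.1, h2.2]
    · intro h
      rcases this.1 with h1 | h1 <;> rcases hs with h2 | h2
      · exact h2.1
      · linarith [h1.1, h1.2, h2.1, h2.2]
      · linarith [h1.1, h1.2, h2.1, h2.2]
      · exact absurd h1.2 h

/-- Each of the three sources would need a port opposite to those of the others. -/
lemma false_of_outerLayout : False := by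
  have h0 := opposite_sources L 0
  have h1 := opposite_sources L 1
  have h2 := opposite_sources L 2
  have e0 : (0 : Fin 3) + 1 = 1 := rfl
  have e1 : (1 : Fin 3) + 1 = 2 := rfl
  have e2 : (2 : Fin 3) + 1 = 0 := rfl
  simp only [e0, e1, e2] at h0 h1 h2
  -- The two cyclic selections fail by parity of the ports. In the other six cases two sources
  -- select each other, and the x-order at their common sink is contradictory.
  rcases h0 with ⟨p0, q0⟩ | ⟨p0, q0⟩ <;> rcases h1 with ⟨p1, q1⟩ | ⟨p1, q1⟩ <;>
    rcases h2 with ⟨p2, q2⟩ | ⟨p2, q2⟩ <;>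
    first
      | tauto
      | (rcases q0 with q0 | q0 <;> rcases q1 with q1 | q1 <;> rcases q2 with q2 | q2 <;> linarith)

end NoLayout

lemma eq_zero_of_leaf {c : Fin 18 → Fin 18 → ℤ} (hc : IsCirculation digraph.Adj c) (i : Fin 6) :
    (∀ v, c (Fin.natAdd 12 i) v = 0) ∧ ∀ v, c v (Fin.natAdd 12 i) = 0 := by
  have key : ∀ i : Fin 6,
      ((∀ u, ¬ digraph.Adj u (Fin.natAdd 12 i)) ∧ ∀ v w, digraph.Adj (Fin.natAdd 12 i) v →
        digraph.Adj (Fin.natAdd 12 i) w → v = w) ∨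
      ((∀ u, ¬ digraph.Adj (Fin.natAdd 12 i) u) ∧ ∀ v w, digraph.Adj v (Fin.natAdd 12 i) →
        digraph.Adj w (Fin.natAdd 12 i) → v = w) := by
    decide +kernel
  rcases key i with h | h
  · exact ⟨hc.eq_zero_of_unique h.1 h.2, fun v => by_contra fun h0 => h.1 v (hc.adj _ _ h0)⟩
  · exact ⟨fun v => by_contra fun h0 => h.1 v (hc.adj _ _ h0), hc.swap.eq_zero_of_unique h.1 h.2⟩

/-- The digraph has no outerplanar L-drawing. -/
theorem not_exists_isOuterplanar : ¬ ∃ Γ : LDrawing (Fin 18), Γ.IsOuterplanar digraph := by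
  rintro ⟨Γ, hΓ⟩
  have key : ∀ s, ((∀ v w, digraph.Adj s v → digraph.Adj s w → v = w) ∧
      ∀ v w, digraph.Adj v s → digraph.Adj w s → v = w) ∨
      ∃ i : Fin 6, ((∀ v w, digraph.Adj (Fin.natAdd 12 i) v →
        digraph.Adj (Fin.natAdd 12 i) w → v = w) ∧
        ∀ v w, digraph.Adj v (Fin.natAdd 12 i) → digraph.Adj w (Fin.natAdd 12 i) → v = w) ∧
        (digraph.Adj s (Fin.natAdd 12 i) ∨ digraph.Adj (Fin.natAdd 12 i) s) := by
    decide +kernel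
  refine false_of_outerLayout ((hΓ.outerLayout ?_ ?_).extend fun s => ?_)
  · decide +kernel
  · decide +kernel
  · rcases key s with h | ⟨i, h, h'⟩
    · exact Or.inl h
    · exact Or.inr ⟨_, h, h', fun c hc => eq_zero_of_leaf hc i⟩

end Hexagon

/-! ### Faces of rotation systems and mirror images -/

lemma apply_inv_apply {α : Type*} (e : Equiv.Perm α) (a : α) : e (e⁻¹ a) = a :=
  e.apply_symm_apply a

namespace RotationSystem

variable {V : Type*} {H : SimpleGraph V} (R : RotationSystem H)

lemma facePerm_apply (d : H.Dart) : R.facePerm d = R.rot d.symm := rfl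

lemma rot_eq_facePerm (d : H.Dart) : R.rot d = R.facePerm d.symm := by
  rw [facePerm_apply, SimpleGraph.Dart.symm_symm]

lemma facePerm_fst (d : H.Dart) : (R.facePerm d).fst = d.snd := R.rot_fst d.symm

/-- The face permutation only turns back at vertices of degree one. -/
lemma eq_symm_of_facePerm_eq_symm {d : H.Dart} (h : R.facePerm d = d.symm) {d' : H.Dart}
    (hd' : d'.fst = d.snd) : d' = d.symm := by
  have h1 : R.rot.SameCycle d.symm d' := R.rot_sameCycle _ _ hd'.symm
  exact (h1.eq_of_left h).symm

lemma facePerm_ne_symm {d : H.Dart} {d₁ d₂ : H.Dart} (h₁ : d₁.fst = d.snd) (h₂ : d₂.fst = d.snd)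
    (hne : d₁ ≠ d₂) : R.facePerm d ≠ d.symm := fun h =>
  hne ((R.eq_symm_of_facePerm_eq_symm h h₁).trans (R.eq_symm_of_facePerm_eq_symm h h₂).symm)

/-- The set of darts of the face of `d`. -/
def face (d : H.Dart) : Set H.Dart := {d' | R.facePerm.SameCycle d d'}

lemma face_mem_faces (d : H.Dart) : R.face d ∈ R.faces := ⟨d, rfl⟩

lemma mem_face_self (d : H.Dart) : d ∈ R.face d := Equiv.Perm.SameCycle.refl _ _

lemma face_eq_of_mem {d d' : H.Dart} (h : d' ∈ R.face d) : R.face d' = R.face d :=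
  Set.ext fun _ => ⟨fun h' => Equiv.Perm.SameCycle.trans h h',
    fun h' => (Equiv.Perm.SameCycle.symm h).trans h'⟩

lemma eq_face_of_mem {f : Set H.Dart} (hf : f ∈ R.faces) {d : H.Dart} (hd : d ∈ f) :
    f = R.face d := by
  obtain ⟨d', rfl⟩ := hf
  exact (R.face_eq_of_mem hd).symm

lemma facePerm_mem_iff {f : Set H.Dart} (hf : f ∈ R.faces) {d : H.Dart} :
    R.facePerm d ∈ f ↔ d ∈ f := by
  obtain ⟨d', rfl⟩ := hf
  exact Equiv.Perm.sameCycle_apply_right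

/-- The mirror image of a rotation system. -/
def reflect : RotationSystem H where
  rot := R.rot⁻¹
  rot_fst d := by
    have := R.rot_fst (R.rot⁻¹ d)
    rw [apply_inv_apply] at this
    exact this.symm
  rot_sameCycle d d' h := (R.rot_sameCycle d d' h).inv

lemma reflect_facePerm_symm (d : H.Dart) :
    R.reflect.facePerm d.symm = (R.facePerm⁻¹ d).symm := by
  rw [facePerm_apply, SimpleGraph.Dart.symm_symm]
  apply R.rot.injective
  rw [← facePerm_apply, apply_inv_apply]
  exact apply_inv_apply _ _

/-- Reversal of darts as a permutation. -/
def symmPerm (H : SimpleGraph V) : Equiv.Perm H.Dart :=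
  SimpleGraph.Dart.symm_involutive.toPerm SimpleGraph.Dart.symm

lemma reflect_facePerm :
    R.reflect.facePerm = symmPerm H * R.facePerm⁻¹ * (symmPerm H)⁻¹ := by
  ext1 d
  obtain ⟨d, rfl⟩ : ∃ d', d = SimpleGraph.Dart.symm d' := ⟨d.symm, by simp⟩
  rw [reflect_facePerm_symm, Equiv.Perm.mul_apply, Equiv.Perm.mul_apply]
  congr 2

lemma reflect_face_symm (d : H.Dart) :
    R.reflect.face d.symm = SimpleGraph.Dart.symm '' R.face d := by
  ext d'
  have h1 : ∀ e, (symmPerm H)⁻¹ e = e.symm := fun e => by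
    rw [Equiv.Perm.inv_eq_iff_eq]
    exact (SimpleGraph.Dart.symm_symm e).symm
  simp only [face, Set.mem_ofPred_eq, reflect_facePerm, Equiv.Perm.sameCycle_conj, h1,
    Equiv.Perm.sameCycle_inv, SimpleGraph.Dart.symm_symm, Set.mem_image]
  constructor
  · intro h
    exact ⟨_, h, by simp⟩
  · rintro ⟨e, he, rfl⟩
    simpa using he

lemma reflect_faces : R.reflect.faces = (fun f => SimpleGraph.Dart.symm '' f) '' R.faces := by
  ext f
  constructor
  · rintro ⟨d, rfl⟩
    refine ⟨R.face d.symm, R.face_mem_faces _, ?_⟩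
    change _ = R.reflect.face d
    exact ((R.reflect_face_symm d.symm).symm.trans (by rw [SimpleGraph.Dart.symm_symm]))
  · rintro ⟨_, ⟨d, rfl⟩, rfl⟩
    exact ⟨d.symm, R.reflect_face_symm d⟩

end RotationSystem

namespace OuterplanarEmbedding

variable {V : Type*} {H : SimpleGraph V}

/-- The mirror image of an outerplanar embedding. -/
def reflect (E : OuterplanarEmbedding H) : OuterplanarEmbedding H where
  toRotationSystem := E.toRotationSystem.reflect
  planar := by
    refine ⟨E.planar.1, ?_⟩
    rw [RotationSystem.reflect_faces, Set.ncard_image_of_injective]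
    · exact E.planar.2
    · exact (SimpleGraph.Dart.symm_involutive.injective).image_injective
  outer := SimpleGraph.Dart.symm '' E.outer
  outer_mem := by
    rw [RotationSystem.reflect_faces]
    exact ⟨_, E.outer_mem, rfl⟩
  outer_spanning v := by
    obtain ⟨d, hd, rfl⟩ := E.outer_spanning v
    -- The predecessor of `d` in its face ends where `d` starts, so its reversal starts there.
    refine ⟨(E.facePerm⁻¹ d).symm, ⟨_, ?_, rfl⟩, ?_⟩
    · rwa [← E.toRotationSystem.facePerm_mem_iff E.outer_mem, apply_inv_apply]
    · have := E.facePerm_fst (E.facePerm⁻¹ d)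
      rw [apply_inv_apply] at this
      exact this.symm

end OuterplanarEmbedding

/-! ### Uniqueness of the outerplanar embedding -/

namespace Hexagon

/-- The underlying graph of the digraph. -/
abbrev graph : SimpleGraph (Fin 18) := digraph.toSimpleGraphInclusive

instance : DecidableRel graph.Adj := fun u v =>
  inferInstanceAs (Decidable (u ≠ v ∧ ((u, v) ∈ arcs ∨ (v, u) ∈ arcs)))

/-- The vertices of the hexagon in cyclic order. -/
def hex (i : Fin 6) : Fin 18 := ⟨i.val, by omega⟩

/-- The apex of the triangle on the edge between `hex i` and `hex (i + 1)`. -/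
def tip (i : Fin 6) : Fin 18 := ⟨6 + i.val, by omega⟩

/-- The leaf at `hex i`. -/
def leaf (i : Fin 6) : Fin 18 := ⟨12 + i.val, by omega⟩

/-- The dart from `hex i` to `hex (i + 1)`. -/
def fwd (i : Fin 6) : graph.Dart := ⟨(hex i, hex (i + 1)), by revert i; decide +kernel⟩

/-- The dart from `hex (i + 1)` to `hex i`. -/
def bwd (i : Fin 6) : graph.Dart := ⟨(hex (i + 1), hex i), by revert i; decide +kernel⟩

/-- The dart from `hex i` to `tip i`. -/
def up (i : Fin 6) : graph.Dart := ⟨(hex i, tip i), by revert i; decide +kernel⟩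

/-- The dart from `hex (i + 1)` to `tip i`. -/
def up' (i : Fin 6) : graph.Dart := ⟨(hex (i + 1), tip i), by revert i; decide +kernel⟩

/-- The dart from `tip i` to `hex i`. -/
def down (i : Fin 6) : graph.Dart := ⟨(tip i, hex i), by revert i; decide +kernel⟩

/-- The dart from `tip i` to `hex (i + 1)`. -/
def down' (i : Fin 6) : graph.Dart := ⟨(tip i, hex (i + 1)), by revert i; decide +kernel⟩

/-- The dart from `hex i` to `leaf i`. -/
def toLeaf (i : Fin 6) : graph.Dart := ⟨(hex i, leaf i), by revert i; decide +kernel⟩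

/-- The dart from `leaf i` to `hex i`. -/
def fromLeaf (i : Fin 6) : graph.Dart := ⟨(leaf i, hex i), by revert i; decide +kernel⟩

lemma eq_of_fst_eq_hex (i : Fin 6) (d : graph.Dart) : d.fst = hex (i + 1) →
    d = fwd (i + 1) ∨ d = bwd i ∨ d = up (i + 1) ∨ d = up' i ∨ d = toLeaf (i + 1) := by
  revert i d
  decide +kernel

lemma eq_of_fst_eq_tip (i : Fin 6) (d : graph.Dart) :
    d.fst = tip i → d = down i ∨ d = down' i := by
  revert i d
  decide +kernel

lemma eq_of_fst_eq_leaf (i : Fin 6) (d : graph.Dart) : d.fst = leaf i → d = fromLeaf i := by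
  revert i d
  decide +kernel

lemma dart_cases (d : graph.Dart) : ∃ i, d = fwd i ∨ d = bwd i ∨ d = up i ∨ d = up' i ∨
    d = down i ∨ d = down' i ∨ d = toLeaf i ∨ d = fromLeaf i := by
  revert d
  decide +kernel

/-- Weights of the darts for a discharging argument. -/
def weight (d : graph.Dart) : ℕ :=
  if 6 ≤ d.snd.val ∧ d.snd.val < 12 then 5 else if d.fst.val < 6 ∧ d.snd.val < 6 then 1 else 0

/-- Twelve darts to apices of weight 5 and twelve hexagon darts of weight 1. The values are chosen
so that the total is exactly `30 + 7 * 6`. -/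
lemma sum_weight : ∑ d, weight d = 72 := by decide +kernel

end Hexagon

namespace Hexagon

lemma cyclic_induction {P : Fin 6 → Prop} (h : ∀ i, P i → P (i + 1)) {i : Fin 6} (hi : P i)
    (j : Fin 6) : P j := by
  have key : ∀ i j : Fin 6, j = i ∨ j = i + 1 ∨ j = i + 1 + 1 ∨ j = i + 1 + 1 + 1 ∨
      j = i + 1 + 1 + 1 + 1 ∨ j = i + 1 + 1 + 1 + 1 + 1 := by
    decide
  rcases key i j with rfl | rfl | rfl | rfl | rfl | rfl
  exacts [hi, h _ hi, h _ (h _ hi), h _ (h _ (h _ hi)), h _ (h _ (h _ (h _ hi))),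
    h _ (h _ (h _ (h _ (h _ hi))))]

lemma cyclic_induction_down {P : Fin 6 → Prop} (h : ∀ i, P (i + 1) → P i) {i : Fin 6} (hi : P i)
    (j : Fin 6) : P j := by
  have := cyclic_induction (P := fun k => P (-k)) (i := -i)
    (fun k hk => h _ (by rwa [neg_add, neg_add_cancel_right])) (by rwa [neg_neg]) (-j)
  rwa [neg_neg] at this

lemma fwd_injective : Function.Injective fwd := by decide +kernel

lemma bwd_injective : Function.Injective bwd := by decide +kernel

lemma exists_ne_symm (d : graph.Dart) :
    d.snd.val < 12 → ∃ d' : graph.Dart, d'.fst = d.snd ∧ d' ≠ d.symm := by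
  revert d
  decide +kernel

lemma snd_lt_of_fst (d : graph.Dart) : 6 ≤ d.fst.val → d.snd.val < 6 := by
  revert d
  decide +kernel

lemma eq_toLeaf (d : graph.Dart) : 12 ≤ d.snd.val → ∃ i, d = toLeaf i := by
  revert d
  decide +kernel

lemma snd_lt (i : Fin 6) : (fwd i).snd.val < 12 ∧ (bwd i).snd.val < 12 ∧ (up i).snd.val < 12 ∧
    (up' i).snd.val < 12 := by
  revert i
  decide +kernel

lemma weight_pos (d : graph.Dart) : d.fst.val < 6 → d.snd.val < 12 → 0 < weight d := by
  revert d
  decide +kernel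

lemma weight_up (i : Fin 6) : weight (up i) = 5 ∧ weight (up' i) = 5 := by
  revert i
  decide +kernel

lemma natCard_edgeSet : Nat.card graph.edgeSet = 24 := by
  rw [Nat.card_eq_fintype_card, ← SimpleGraph.edgeFinset_card]
  have h1 := graph.dart_card_eq_twice_card_edges
  have h2 : Fintype.card graph.Dart = 48 := by decide +kernel
  omega

section Uniqueness

variable (E : OuterplanarEmbedding graph)

lemma facePerm_ne_symm {d : graph.Dart} (hd : d.snd.val < 12) : E.facePerm d ≠ d.symm := by
  obtain ⟨d', h, h'⟩ := exists_ne_symm d hd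
  exact fun e => h' (E.eq_symm_of_facePerm_eq_symm e h)

lemma facePerm_up (i : Fin 6) : E.facePerm (up i) = down' i := by
  refine (eq_of_fst_eq_tip i _ (E.facePerm_fst _)).resolve_left fun e => ?_
  exact facePerm_ne_symm E (d := up i) (snd_lt i).2.2.1 e

lemma facePerm_up' (i : Fin 6) : E.facePerm (up' i) = down i := by
  refine (eq_of_fst_eq_tip i _ (E.facePerm_fst _)).resolve_right fun e => ?_
  exact facePerm_ne_symm E (d := up' i) (snd_lt i).2.2.2 e

lemma facePerm_toLeaf (i : Fin 6) : E.facePerm (toLeaf i) = fromLeaf i :=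
  eq_of_fst_eq_leaf i _ (E.facePerm_fst _)

lemma fromLeaf_mem_outer (i : Fin 6) : fromLeaf i ∈ E.outer := by
  obtain ⟨d, hd, h⟩ := E.outer_spanning (leaf i)
  rwa [← eq_of_fst_eq_leaf i d h]

lemma toLeaf_mem_outer (i : Fin 6) : toLeaf i ∈ E.outer := by
  rw [← E.facePerm_mem_iff E.outer_mem, facePerm_toLeaf]
  exact fromLeaf_mem_outer E i

lemma up_mem_outer_or (i : Fin 6) : up i ∈ E.outer ∨ up' i ∈ E.outer := by
  obtain ⟨d, hd, h⟩ := E.outer_spanning (tip i)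
  rw [← E.facePerm_mem_iff E.outer_mem, ← E.facePerm_mem_iff E.outer_mem (d := up' i),
    facePerm_up, facePerm_up']
  rcases eq_of_fst_eq_tip i d h with rfl | rfl
  · exact Or.inr hd
  · exact Or.inl hd

variable {E}

lemma facePerm_notMem {d : graph.Dart} (hd : d ∉ E.outer) : E.facePerm d ∉ E.outer :=
  fun h => hd ((E.facePerm_mem_iff E.outer_mem).1 h)

lemma notMem_outer_of_mem_face {d x : graph.Dart} (hd : d ∉ E.outer) (hx : x ∈ E.face d) :
    x ∉ E.outer := fun h => hd <| by
  rw [E.eq_face_of_mem E.outer_mem h, E.face_eq_of_mem hx]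
  exact E.mem_face_self d

lemma snd_lt_of_notMem {d : graph.Dart} (hd : d ∉ E.outer) : d.snd.val < 12 := by
  by_contra h
  obtain ⟨i, rfl⟩ := eq_toLeaf d (not_lt.1 h)
  exact hd (toLeaf_mem_outer E i)

lemma facePerm_mem_face {d x : graph.Dart} (hx : x ∈ E.face d) : E.facePerm x ∈ E.face d :=
  (E.facePerm_mem_iff (E.face_mem_faces d)).2 hx

/-- After a dart to an apex, an inner face continues with a dart of positive weight. -/
lemma weight_facePerm_facePerm {x : graph.Dart} (hx : x ∉ E.outer) (h6 : 6 ≤ x.snd.val) :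
    0 < weight (E.facePerm (E.facePerm x)) ∧ E.facePerm (E.facePerm x) ≠ x := by
  have h1 : (E.facePerm x).fst = x.snd := E.facePerm_fst x
  have h2 : (E.facePerm (E.facePerm x)).fst = (E.facePerm x).snd := E.facePerm_fst _
  constructor
  · refine weight_pos _ ?_ (snd_lt_of_notMem (facePerm_notMem (facePerm_notMem hx)))
    rw [h2]
    exact snd_lt_of_fst _ (by rwa [h1])
  · intro e
    rw [e] at h2
    refine facePerm_ne_symm E (snd_lt_of_notMem hx) ?_
    exact SimpleGraph.Dart.ext _ _ (Prod.ext h1 h2.symm)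

-- An inner face through an apex has a dart of weight 5 and a further one of positive weight. Any
-- other inner face cannot turn back or visit a leaf, so it runs around the whole hexagon.
open Classical in
lemma six_le_sum_weight_face {d : graph.Dart} (hd : d ∉ E.outer) :
    6 ≤ ∑ x with x ∈ E.face d, weight x := by
  by_cases hup : ∃ i, up i ∈ E.face d ∨ up' i ∈ E.face d
  · obtain ⟨x, hx, h6, h5⟩ : ∃ x ∈ E.face d, 6 ≤ x.snd.val ∧ weight x = 5 := by
      obtain ⟨i, h | h⟩ := hup
      · exact ⟨_, h, Nat.le_add_right _ _, (weight_up i).1⟩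
      · exact ⟨_, h, Nat.le_add_right _ _, (weight_up i).2⟩
    have hy := weight_facePerm_facePerm (notMem_outer_of_mem_face hd hx) h6
    calc 6 ≤ weight x + weight (E.facePerm (E.facePerm x)) := by omega
      _ = ∑ z ∈ {x, E.facePerm (E.facePerm x)}, weight z := (Finset.sum_pair hy.2.symm).symm
      _ ≤ _ := by
        refine Finset.sum_le_sum_of_subset fun z hz => ?_
        rw [Finset.mem_filter_univ]
        rcases Finset.mem_insert.1 hz with rfl | hz
        · exact hx
        · rw [Finset.mem_singleton.1 hz]
          exact facePerm_mem_face (facePerm_mem_face hx)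
  · push Not at hup
    have hleaf : ∀ i, toLeaf i ∉ E.face d := fun i h =>
      notMem_outer_of_mem_face hd h (toLeaf_mem_outer E i)
    have main : (∀ j, fwd j ∈ E.face d) ∨ ∀ j, bwd j ∈ E.face d := by
      have hd' := E.mem_face_self d
      obtain ⟨i, h⟩ := dart_cases d
      rcases h with h | h | h | h | h | h | h | h
      · left
        refine cyclic_induction (fun i hi => ?_) (i := i) (h ▸ hd')
        have hφ := facePerm_mem_face hi
        rcases eq_of_fst_eq_hex i _ (E.facePerm_fst (fwd i)) with e | e | e | e | e
        · rwa [e] at hφ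
        · exact (facePerm_ne_symm E (d := fwd i) (snd_lt i).1 e).elim
        · exact ((hup _).1 (e ▸ hφ)).elim
        · exact ((hup _).2 (e ▸ hφ)).elim
        · exact (hleaf _ (e ▸ hφ)).elim
      · right
        refine cyclic_induction_down (fun i hi => ?_) (i := i) (h ▸ hd')
        have hφ := facePerm_mem_face hi
        rcases eq_of_fst_eq_hex i _ (E.facePerm_fst (bwd (i + 1))) with e | e | e | e | e
        · exact (facePerm_ne_symm E (d := bwd (i + 1)) (snd_lt (i + 1)).2.1 e).elim
        · rwa [e] at hφ
        · exact ((hup _).1 (e ▸ hφ)).elim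
        · exact ((hup _).2 (e ▸ hφ)).elim
        · exact (hleaf _ (e ▸ hφ)).elim
      · exact ((hup i).1 (h ▸ hd')).elim
      · exact ((hup i).2 (h ▸ hd')).elim
      · refine ((hup i).2 ((E.facePerm_mem_iff (E.face_mem_faces d)).1 ?_)).elim
        rwa [facePerm_up', ← h]
      · refine ((hup i).1 ((E.facePerm_mem_iff (E.face_mem_faces d)).1 ?_)).elim
        rwa [facePerm_up, ← h]
      · exact (hd (h ▸ toLeaf_mem_outer E i)).elim
      · exact (hd (h ▸ fromLeaf_mem_outer E i)).elim
    rcases main with h | h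
    · calc 6 = ∑ i, weight (fwd i) := by decide +kernel
        _ = ∑ x ∈ Finset.univ.image fwd, weight x :=
          (Finset.sum_image fwd_injective.injOn).symm
        _ ≤ _ := by
          refine Finset.sum_le_sum_of_subset fun z hz => ?_
          obtain ⟨i, -, rfl⟩ := Finset.mem_image.1 hz
          exact (Finset.mem_filter_univ _).2 (h i)
    · calc 6 = ∑ i, weight (bwd i) := by decide +kernel
        _ = ∑ x ∈ Finset.univ.image bwd, weight x :=
          (Finset.sum_image bwd_injective.injOn).symm
        _ ≤ _ := by
          refine Finset.sum_le_sum_of_subset fun z hz => ?_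
          obtain ⟨i, -, rfl⟩ := Finset.mem_image.1 hz
          exact (Finset.mem_filter_univ _).2 (h i)

open Classical in
/-- A selection of darts to the apices in the outer face, possibly together with one more dart,
has its share of the weight. -/
lemma sum_weight_le_outer {u : Fin 6 → graph.Dart} (hu : ∀ i, u i ∈ E.outer)
    (hu' : ∀ i, u i = up i ∨ u i = up' i) {s : Finset graph.Dart} (hs : ∀ x ∈ s, x ∈ E.outer)
    (hs' : ∀ x ∈ s, ∀ i, x ≠ u i) :
    30 + ∑ x ∈ s, weight x ≤ ∑ x with x ∈ E.outer, weight x := by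
  have hinj : Function.Injective u := by
    have key : ∀ i j : Fin 6, (up i = up j → i = j) ∧ (up i = up' j → i = j) ∧
        (up' i = up j → i = j) ∧ (up' i = up' j → i = j) := by
      decide +kernel
    intro i j h
    rcases hu' i with hi | hi <;> rcases hu' j with hj | hj <;> rw [hi, hj] at h
    exacts [(key i j).1 h, (key i j).2.1 h, (key i j).2.2.1 h, (key i j).2.2.2 h]
  have h30 : ∑ i, weight (u i) = 30 := by
    rw [Finset.sum_congr rfl (g := fun _ => 5)]
    · rfl
    · intro i _
      rcases hu' i with h | h <;> rw [h]
      exacts [(weight_up i).1, (weight_up i).2]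
  calc 30 + ∑ x ∈ s, weight x = ∑ x ∈ Finset.univ.image u, weight x + ∑ x ∈ s, weight x := by
        rw [Finset.sum_image hinj.injOn, h30]
    _ = ∑ x ∈ Finset.univ.image u ∪ s, weight x := by
        refine (Finset.sum_union ?_).symm
        rw [Finset.disjoint_right]
        intro x hx hx'
        obtain ⟨i, -, rfl⟩ := Finset.mem_image.1 hx'
        exact hs' _ hx i rfl
    _ ≤ _ := by
        refine Finset.sum_le_sum_of_subset fun z hz => ?_
        rw [Finset.mem_filter_univ]
        rcases Finset.mem_union.1 hz with h | h
        · obtain ⟨i, -, rfl⟩ := Finset.mem_image.1 h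
          exact hu i
        · exact hs z h

variable (E) in
open Classical in
lemma exists_inner_faces : ∃ F : Finset (Set graph.Dart), F.card = 7 ∧
    (∀ d ∉ E.outer, E.face d ∈ F) ∧ (∀ f ∈ F, ∃ d ∉ E.outer, f = E.face d) ∧
    ∑ f ∈ F, ∑ x with x ∈ f, weight x = ∑ x with x ∉ E.outer, weight x := by
  have hfin : E.faces.Finite := Set.toFinite _
  -- Euler's formula with 18 vertices and 24 edges.
  have hcard : E.faces.ncard = 8 := by
    have := E.planar.2
    rw [natCard_edgeSet, Nat.card_eq_fintype_card, Fintype.card_fin] at this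
    omega
  have hmem : ∀ f, f ∈ hfin.toFinset.erase E.outer ↔ f ≠ E.outer ∧ f ∈ E.faces := by
    simp
  have h1 : ∀ d ∉ E.outer, E.face d ∈ hfin.toFinset.erase E.outer := fun d hd =>
    (hmem _).2 ⟨fun e => hd (e ▸ E.mem_face_self d), E.face_mem_faces d⟩
  have h2 : ∀ f ∈ hfin.toFinset.erase E.outer, ∃ d ∉ E.outer, f = E.face d := by
    intro f hf
    obtain ⟨hne, d, rfl⟩ := (hmem f).1 hf
    refine ⟨d, fun hd => hne ?_, rfl⟩
    exact (E.eq_face_of_mem E.outer_mem hd).symm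
  refine ⟨hfin.toFinset.erase E.outer, ?_, h1, h2, ?_⟩
  · rw [Finset.card_erase_of_mem (hfin.mem_toFinset.2 E.outer_mem),
      ← Set.ncard_eq_toFinset_card _ hfin, hcard]
  · rw [← Finset.sum_fiberwise_of_maps_to (g := E.face) fun d hd =>
      h1 d (Finset.mem_filter.1 hd).2]
    refine Finset.sum_congr rfl fun f hf => ?_
    congr 1
    ext x
    obtain ⟨d, hd, rfl⟩ := h2 f hf
    simp only [Finset.mem_filter, Finset.mem_univ, true_and]
    constructor
    · exact fun h => ⟨notMem_outer_of_mem_face hd h, E.face_eq_of_mem h⟩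
    · exact fun h => h.2 ▸ E.mem_face_self x

variable (E) in
open Classical in
/-- The weights of the faces are as small as possible. -/
lemma sum_weight_eq : ∑ x with x ∈ E.outer, weight x = 30 ∧
    ∀ d ∉ E.outer, ∑ x with x ∈ E.face d, weight x = 6 := by
  obtain ⟨F, hF, hF1, hF2, hsum⟩ := exists_inner_faces E
  have htot := Finset.sum_filter_add_sum_filter_not Finset.univ (· ∈ E.outer) weight
  rw [sum_weight, ← hsum] at htot
  choose u hu using fun i => (show ∃ x ∈ E.outer, x = up i ∨ x = up' i by
    rcases up_mem_outer_or E i with h | h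
    exacts [⟨_, h, Or.inl rfl⟩, ⟨_, h, Or.inr rfl⟩])
  have hout := sum_weight_le_outer (fun i => (hu i).1) (fun i => (hu i).2) (s := ∅)
    (by simp) (by simp)
  rw [Finset.sum_empty, add_zero] at hout
  have h6 : ∀ f ∈ F, 6 ≤ ∑ x with x ∈ f, weight x := by
    intro f hf
    obtain ⟨d, hd, rfl⟩ := hF2 f hf
    exact six_le_sum_weight_face hd
  have hlow := Finset.card_nsmul_le_sum F _ _ h6
  rw [hF, smul_eq_mul] at hlow
  refine ⟨by omega, fun d hd => ?_⟩
  have hlow' := Finset.card_nsmul_le_sum (F.erase (E.face d)) _ _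
    fun f hf => h6 f (Finset.mem_of_mem_erase hf)
  rw [Finset.card_erase_of_mem (hF1 d hd), hF, smul_eq_mul] at hlow'
  have := Finset.add_sum_erase F (fun f => ∑ x with x ∈ f, weight x) (hF1 d hd)
  have := six_le_sum_weight_face hd
  omega

end Uniqueness

end Hexagon

namespace Hexagon

lemma weight_eq_five (d : graph.Dart) : 6 ≤ d.snd.val → d.snd.val < 12 → weight d = 5 := by
  revert d
  decide +kernel

lemma weight_fwd_bwd (i : Fin 6) : 0 < weight (fwd i) ∧ 0 < weight (bwd i) := by
  revert i
  decide +kernel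

section Uniqueness

variable {E : OuterplanarEmbedding graph}

/-- An inner face through an apex is a triangle. -/
lemma facePerm_iterate_three {d : graph.Dart} (hd : d ∉ E.outer) (h6 : 6 ≤ d.snd.val) :
    E.facePerm (E.facePerm (E.facePerm d)) = d := by
  classical
  by_contra hne
  have hy := weight_facePerm_facePerm hd h6
  have hd5 := weight_eq_five d h6 (snd_lt_of_notMem hd)
  have h1 := facePerm_notMem (facePerm_notMem hd)
  have hmem := facePerm_mem_face (facePerm_mem_face (E.mem_face_self d))
  have hmem' := facePerm_mem_face hmem
  have hfst := E.facePerm_fst (E.facePerm (E.facePerm d))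
  set y := E.facePerm (E.facePerm d)
  set z := E.facePerm y
  have hle : ∀ s : Finset graph.Dart, (∀ x ∈ s, x ∈ E.face d) → ∑ x ∈ s, weight x ≤ 6 := by
    intro s hs
    rw [← (sum_weight_eq E).2 d hd]
    exact Finset.sum_le_sum_of_subset fun x hx => (Finset.mem_filter_univ _).2 (hs x hx)
  -- Of the weight 6 of the face, `d` takes 5 and leaves 1 for `y`, which therefore ends in the
  -- hexagon; a third dart `z` of positive weight would exceed the bound.
  have h2 := hle {d, y} (by
    intro x hx
    rcases Finset.mem_insert.1 hx with rfl | hx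
    · exact E.mem_face_self x
    · rwa [Finset.mem_singleton.1 hx])
  rw [Finset.sum_pair hy.2.symm] at h2
  have hy6 : y.snd.val < 6 := by
    by_contra h
    have := weight_eq_five y (not_lt.1 h) (snd_lt_of_notMem h1)
    omega
  have hz : 0 < weight z := by
    refine weight_pos z ?_ (snd_lt_of_notMem (facePerm_notMem h1))
    rwa [hfst]
  have hzy : y ≠ z := by
    intro e
    rw [← e] at hfst
    exact y.fst_ne_snd hfst
  have h3 := hle {d, y, z} (by
    intro x hx
    rcases Finset.mem_insert.1 hx with rfl | hx
    · exact E.mem_face_self x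
    rcases Finset.mem_insert.1 hx with rfl | hx
    · exact hmem
    · rwa [Finset.mem_singleton.1 hx])
  rw [Finset.sum_insert, Finset.sum_pair hzy] at h3
  · omega
  · simp [hy.2.symm, Ne.symm hne]

/-- The six selected darts exhaust the weight 30 of the outer face. -/
lemma exists_eq_of_mem_outer {u : Fin 6 → graph.Dart} (hu : ∀ i, u i ∈ E.outer)
    (hu' : ∀ i, u i = up i ∨ u i = up' i) {x : graph.Dart} (hx : x ∈ E.outer)
    (hpos : 0 < weight x) : ∃ i, x = u i := by
  by_contra! h
  have := sum_weight_le_outer hu hu' (s := {x})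
    (fun y hy => by rwa [Finset.mem_singleton.1 hy])
    (fun y hy => by rwa [Finset.mem_singleton.1 hy])
  rw [Finset.sum_singleton, (sum_weight_eq E).1] at this
  omega

variable (E) in
lemma exists_selection : ∃ u : Fin 6 → graph.Dart, (∀ i, u i ∈ E.outer) ∧
    ∀ i, u i = up i ∨ u i = up' i := by
  choose u hu using fun i => (show ∃ x ∈ E.outer, x = up i ∨ x = up' i by
    rcases up_mem_outer_or E i with h | h
    exacts [⟨_, h, Or.inl rfl⟩, ⟨_, h, Or.inr rfl⟩])
  exact ⟨u, fun i => (hu i).1, fun i => (hu i).2⟩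

variable (E) in
lemma fwd_notMem_outer (i : Fin 6) : fwd i ∉ E.outer := by
  obtain ⟨u, hu, hu'⟩ := exists_selection E
  intro h
  obtain ⟨j, hj⟩ := exists_eq_of_mem_outer hu hu' h (weight_fwd_bwd i).1
  have key : ∀ i j, fwd i ≠ up j ∧ fwd i ≠ up' j := by decide +kernel
  rcases hu' j with h' | h'
  exacts [(key i j).1 (hj.trans h'), (key i j).2 (hj.trans h')]

lemma up'_notMem_outer {i : Fin 6} (h : up i ∈ E.outer) : up' i ∉ E.outer := by
  obtain ⟨u, hu, hu'⟩ := exists_selection E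
  intro h'
  have key : ∀ i j, (up i = up j → i = j) ∧ (up' i = up' j → i = j) ∧ up i ≠ up' j := by
    decide +kernel
  have h1 : u i = up i := by
    obtain ⟨j, hj⟩ := exists_eq_of_mem_outer hu hu' h (by rw [(weight_up i).1]; norm_num)
    rcases hu' j with hj' | hj'
    · obtain rfl := (key i j).1 (hj.trans hj')
      exact hj.symm
    · exact ((key i j).2.2 (hj.trans hj')).elim
  have h2 : u i = up' i := by
    obtain ⟨j, hj⟩ := exists_eq_of_mem_outer hu hu' h' (by rw [(weight_up i).2]; norm_num)
    rcases hu' j with hj' | hj'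
    · exact ((key j i).2.2 (hj'.symm.trans hj.symm)).elim
    · obtain rfl := (key i j).2.1 (hj.trans hj')
      exact hj.symm
  exact (key i i).2.2 (h1.symm.trans h2)

lemma facePerm_bwd {i : Fin 6} (h : up i ∉ E.outer) :
    E.facePerm (down' i) = bwd i ∧ E.facePerm (bwd i) = up i := by
  have h3 := facePerm_iterate_three h (Nat.le_add_right _ _)
  rw [facePerm_up] at h3
  have key : ∀ (i : Fin 6) (d : graph.Dart), d.fst = hex (i + 1) → d.snd = hex i → d = bwd i := by
    decide +kernel
  have hb : E.facePerm (down' i) = bwd i := by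
    refine key i _ (E.facePerm_fst _) ?_
    rw [← E.facePerm_fst, h3]
    rfl
  exact ⟨hb, by rwa [hb] at h3⟩

lemma facePerm_fwd_of_up' {i : Fin 6} (h : up' i ∉ E.outer) :
    E.facePerm (down i) = fwd i ∧ E.facePerm (fwd i) = up' i := by
  have h3 := facePerm_iterate_three h (Nat.le_add_right _ _)
  rw [facePerm_up'] at h3
  have key : ∀ (i : Fin 6) (d : graph.Dart), d.fst = hex i → d.snd = hex (i + 1) → d = fwd i := by
    decide +kernel
  have hb : E.facePerm (down i) = fwd i := by
    refine key i _ (E.facePerm_fst _) ?_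
    rw [← E.facePerm_fst, h3]
    rfl
  exact ⟨hb, by rwa [hb] at h3⟩

/-- All other continuations fail: `up' i` and the leaf dart are outer, turning back is impossible,
and an inner `up (i + 1)` already has a hexagon dart `bwd (i + 1)` as predecessor. -/
lemma facePerm_fwd {i : Fin 6} (h : up i ∉ E.outer) : E.facePerm (fwd i) = fwd (i + 1) := by
  have hn := facePerm_notMem (fwd_notMem_outer E i)
  rcases eq_of_fst_eq_hex i _ (E.facePerm_fst (fwd i)) with e | e | e | e | e
  · exact e
  · exact (facePerm_ne_symm E (d := fwd i) (snd_lt i).1 e).elim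
  · have h1 : up (i + 1) ∉ E.outer := e ▸ hn
    have := E.facePerm.injective ((facePerm_bwd h1).2.trans e.symm)
    have key : ∀ i j, bwd i ≠ fwd j := by decide +kernel
    exact (key _ _ this).elim
  · exact (hn (e ▸ (up_mem_outer_or E i).resolve_left h)).elim
  · exact (hn (e ▸ toLeaf_mem_outer E _)).elim

/-- A triangle on the other side would give `fwd (i + 1)` a second predecessor, so all triangles
have the same orientation. -/
lemma up_succ_notMem_outer {i : Fin 6} (h : up i ∉ E.outer) : up (i + 1) ∉ E.outer := by
  intro h'
  have := E.facePerm.injective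
    ((facePerm_fwd_of_up' (up'_notMem_outer h')).1.trans (facePerm_fwd h).symm)
  have key : ∀ i j, down i ≠ fwd j := by decide +kernel
  exact key _ _ this

/-- Three of the five darts at the hexagon vertex already have predecessors, and turning back is
impossible. -/
lemma facePerm_fromLeaf (h : ∀ i, up i ∉ E.outer) (i : Fin 6) :
    E.facePerm (fromLeaf (i + 1)) = up' i := by
  have key : ∀ i j, fwd i ≠ fromLeaf j ∧ down' i ≠ fromLeaf j ∧ bwd i ≠ fromLeaf j := by
    decide +kernel
  rcases eq_of_fst_eq_hex i _ (E.facePerm_fst (fromLeaf (i + 1))) with e | e | e | e | e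
  · exact ((key _ _).1 (E.facePerm.injective ((facePerm_fwd (h i)).trans e.symm))).elim
  · exact ((key _ _).2.1 (E.facePerm.injective ((facePerm_bwd (h i)).1.trans e.symm))).elim
  · exact ((key _ _).2.2 (E.facePerm.injective ((facePerm_bwd (h _)).2.trans e.symm))).elim
  · exact e
  · refine (facePerm_ne_symm E (d := fromLeaf (i + 1)) ?_ e).elim
    exact (i + 1).isLt.trans (by norm_num)

lemma facePerm_down (h : ∀ i, up i ∉ E.outer) (i : Fin 6) :
    E.facePerm (down (i + 1)) = toLeaf (i + 1) := by
  have key : ∀ i j, fwd i ≠ down j ∧ down' i ≠ down j ∧ bwd i ≠ down j ∧ fromLeaf i ≠ down j := by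
    decide +kernel
  rcases eq_of_fst_eq_hex i _ (E.facePerm_fst (down (i + 1))) with e | e | e | e | e
  · exact ((key _ _).1 (E.facePerm.injective ((facePerm_fwd (h i)).trans e.symm))).elim
  · exact ((key _ _).2.1 (E.facePerm.injective ((facePerm_bwd (h i)).1.trans e.symm))).elim
  · exact ((key _ _).2.2.1 (E.facePerm.injective ((facePerm_bwd (h _)).2.trans e.symm))).elim
  · exact ((key _ _).2.2.2 (E.facePerm.injective ((facePerm_fromLeaf h i).trans e.symm))).elim
  · exact e

lemma facePerm_eq {E' : OuterplanarEmbedding graph} (hE : up 0 ∉ E.outer) (hE' : up 0 ∉ E'.outer) :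
    E.facePerm = E'.facePerm := by
  have h : ∀ i, up i ∉ E.outer := cyclic_induction (fun _ => up_succ_notMem_outer) hE
  have h' : ∀ i, up i ∉ E'.outer := cyclic_induction (fun _ => up_succ_notMem_outer) hE'
  ext1 d
  obtain ⟨i, hi⟩ := dart_cases d
  obtain ⟨i, rfl⟩ : ∃ j, i = j + 1 := ⟨i - 1, (sub_add_cancel i 1).symm⟩
  rcases hi with rfl | rfl | rfl | rfl | rfl | rfl | rfl | rfl
  · rw [facePerm_fwd (h _), facePerm_fwd (h' _)]
  · rw [(facePerm_bwd (h _)).2, (facePerm_bwd (h' _)).2]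
  · rw [facePerm_up, facePerm_up]
  · rw [facePerm_up', facePerm_up']
  · rw [facePerm_down h, facePerm_down h']
  · rw [(facePerm_bwd (h _)).1, (facePerm_bwd (h' _)).1]
  · rw [facePerm_toLeaf, facePerm_toLeaf]
  · rw [facePerm_fromLeaf h, facePerm_fromLeaf h']

lemma rot_eq_and_outer_eq {E' : OuterplanarEmbedding graph} (hE : up 0 ∉ E.outer)
    (hE' : up 0 ∉ E'.outer) : E'.rot = E.rot ∧ E'.outer = E.outer := by
  have h := facePerm_eq hE hE'
  constructor
  · ext1 d
    rw [E.rot_eq_facePerm, E'.rot_eq_facePerm, h]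
  · rw [E.eq_face_of_mem E.outer_mem (toLeaf_mem_outer E 0),
      E'.eq_face_of_mem E'.outer_mem (toLeaf_mem_outer E' 0)]
    unfold RotationSystem.face
    rw [h]

/-- The outerplanar embedding is unique up to reflection. -/
lemma eqUpToReflection (hE : up 0 ∉ E.outer) (E' : OuterplanarEmbedding graph) :
    E.EqUpToReflection E' := by
  by_cases h : up 0 ∈ E'.outer
  · right
    have h' : up 0 ∉ E'.reflect.outer := by
      rintro ⟨d, hd, e⟩
      have : d = down 0 := by rw [← SimpleGraph.Dart.symm_symm d, e]; rfl
      rw [this, ← facePerm_up' E', E'.facePerm_mem_iff E'.outer_mem] at hd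
      exact up'_notMem_outer h hd
    obtain ⟨h1, h2⟩ := rot_eq_and_outer_eq hE h'
    refine ⟨?_, ?_⟩
    · rw [← h1]
      exact (inv_inv _).symm
    · rw [← h2]
      change _ = SimpleGraph.Dart.symm '' (SimpleGraph.Dart.symm '' E'.outer)
      rw [Set.image_image]
      simp
  · exact Or.inl (rot_eq_and_outer_eq hE h)

end Uniqueness

end Hexagon

/-! ### Existence of the embedding and its inner hexagonal face -/

namespace Hexagon

/-- The neighbours of the vertices in cyclic order. -/
def neighbours : Fin 18 → List (Fin 18) :=
  ![[11, 5, 1, 6, 12], [6, 0, 2, 7, 13], [7, 1, 3, 8, 14], [8, 2, 4, 9, 15], [9, 3, 5, 10, 16],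
    [10, 4, 0, 11, 17], [0, 1], [1, 2], [2, 3], [3, 4], [4, 5], [5, 0], [0], [1], [2], [3], [4], [5]]

lemma adj_formPerm (u v : Fin 18) : graph.Adj u v →
    graph.Adj u ((neighbours u).formPerm v) ∧ graph.Adj u ((neighbours u).formPerm⁻¹ v) := by
  revert u v
  decide +kernel

/-- The rotation of the darts given by the lists of neighbours. -/
def rotation : Equiv.Perm graph.Dart where
  toFun d := ⟨(d.fst, (neighbours d.fst).formPerm d.snd), (adj_formPerm _ _ d.adj).1⟩
  invFun d := ⟨(d.fst, (neighbours d.fst).formPerm⁻¹ d.snd), (adj_formPerm _ _ d.adj).2⟩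
  left_inv _ := SimpleGraph.Dart.ext _ _ (Prod.ext rfl (Equiv.symm_apply_apply _ _))
  right_inv _ := SimpleGraph.Dart.ext _ _ (Prod.ext rfl (Equiv.apply_symm_apply _ _))

lemma eq_rotation (d d' : graph.Dart) : d.fst = d'.fst → d' = d ∨ d' = rotation d ∨
    d' = rotation (rotation d) ∨ d' = rotation (rotation (rotation d)) ∨
    d' = rotation (rotation (rotation (rotation d))) := by
  revert d d'
  decide +kernel

/-- The rotation system of the outerplanar embedding. -/
def rotationSystem : RotationSystem graph where
  rot := rotation
  rot_fst _ := rfl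
  rot_sameCycle d d' h := by
    have step : ∀ {e : graph.Dart}, rotation.SameCycle d e → rotation.SameCycle d (rotation e) :=
      Equiv.Perm.sameCycle_apply_right.2
    have h0 := Equiv.Perm.SameCycle.refl rotation d
    rcases eq_rotation d d' h with e | e | e | e | e <;> rw [e]
    exacts [step h0, step (step h0), step (step (step h0)), step (step (step (step h0)))]

lemma facePerm_rotationSystem (i : Fin 6) :
    rotationSystem.facePerm (fwd i) = fwd (i + 1) ∧ rotationSystem.facePerm (bwd i) = up i ∧
    rotationSystem.facePerm (up i) = down' i ∧ rotationSystem.facePerm (up' i) = down i ∧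
    rotationSystem.facePerm (down i) = toLeaf i ∧
    rotationSystem.facePerm (toLeaf i) = fromLeaf i ∧
    rotationSystem.facePerm (fromLeaf (i + 1)) = up' i := by
  revert i
  decide +kernel

/-- A labelling of the darts by the faces. -/
def faceLabel (d : graph.Dart) : ℕ :=
  if ∃ i, d = fwd i then 7
  else ∑ i : Fin 6, if d = up i ∨ d = bwd i ∨ d = down' i then i.val + 1 else 0

/-- An invariant of the faces: 7 on the hexagon, `i + 1` on the triangles, 0 on the outer face. It
separates the eight representatives. -/
lemma faceLabel_facePerm (d : graph.Dart) :
    faceLabel (rotationSystem.facePerm d) = faceLabel d := by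
  revert d
  decide +kernel

lemma faceLabel_eq {d d' : graph.Dart} (h : d' ∈ rotationSystem.face d) :
    faceLabel d' = faceLabel d := by
  have key : ∀ n : ℕ, faceLabel ((rotationSystem.facePerm ^ n) d) = faceLabel d := by
    intro n
    induction n with
    | zero => rfl
    | succ n ih => rw [pow_succ', Equiv.Perm.mul_apply, faceLabel_facePerm, ih]
  obtain ⟨n, -, hn⟩ := Equiv.Perm.SameCycle.exists_pow_eq' h
  rw [← hn, key]

/-- One dart of every face. -/
def representative : Fin 8 → graph.Dart :=
  ![fwd 0, up 0, up 1, up 2, up 3, up 4, up 5, toLeaf 0]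

lemma face_facePerm (d : graph.Dart) :
    rotationSystem.face (rotationSystem.facePerm d) = rotationSystem.face d :=
  rotationSystem.face_eq_of_mem
    ((rotationSystem.facePerm_mem_iff (rotationSystem.face_mem_faces d)).2
      (rotationSystem.mem_face_self d))

lemma face_fwd (i : Fin 6) : rotationSystem.face (fwd i) = rotationSystem.face (fwd 0) := by
  refine cyclic_induction (P := fun i => rotationSystem.face (fwd i) = _) (fun i hi => ?_)
    (i := 0) rfl i
  rw [← hi, ← (facePerm_rotationSystem i).1, face_facePerm]

lemma face_fromLeaf (i : Fin 6) :
    rotationSystem.face (fromLeaf i) = rotationSystem.face (toLeaf i) := by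
  rw [← (facePerm_rotationSystem i).2.2.2.2.2.1, face_facePerm]

lemma face_down (i : Fin 6) :
    rotationSystem.face (down i) = rotationSystem.face (toLeaf i) := by
  rw [← (facePerm_rotationSystem i).2.2.2.2.1, face_facePerm]

lemma face_up' (i : Fin 6) :
    rotationSystem.face (up' i) = rotationSystem.face (toLeaf i) := by
  rw [← face_facePerm, (facePerm_rotationSystem i).2.2.2.1, face_down]

lemma face_toLeaf (i : Fin 6) :
    rotationSystem.face (toLeaf i) = rotationSystem.face (toLeaf 0) := by
  refine cyclic_induction (P := fun i => rotationSystem.face (toLeaf i) = _) (fun i hi => ?_)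
    (i := 0) rfl i
  rw [← hi, ← face_fromLeaf, ← face_facePerm, (facePerm_rotationSystem i).2.2.2.2.2.2, face_up']

lemma faces_rotationSystem :
    rotationSystem.faces = Set.range fun k => rotationSystem.face (representative k) := by
  have hup : ∀ i : Fin 6, ∃ k, representative k = up i := by decide +kernel
  ext f
  constructor
  · rintro ⟨d, rfl⟩
    change rotationSystem.face d ∈ _
    obtain ⟨i, rfl | rfl | rfl | rfl | rfl | rfl | rfl | rfl⟩ := dart_cases d
    · exact ⟨0, (face_fwd i).symm⟩
    · obtain ⟨k, hk⟩ := hup i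
      refine ⟨k, ?_⟩
      dsimp only
      rw [hk, ← (facePerm_rotationSystem i).2.1, face_facePerm]
    · obtain ⟨k, hk⟩ := hup i
      exact ⟨k, congrArg _ hk⟩
    · exact ⟨7, ((face_up' i).trans (face_toLeaf i)).symm⟩
    · exact ⟨7, ((face_down i).trans (face_toLeaf i)).symm⟩
    · obtain ⟨k, hk⟩ := hup i
      refine ⟨k, ?_⟩
      dsimp only
      rw [hk, ← (facePerm_rotationSystem i).2.2.1, face_facePerm]
    · exact ⟨7, (face_toLeaf i).symm⟩
    · exact ⟨7, ((face_fromLeaf i).trans (face_toLeaf i)).symm⟩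
  · rintro ⟨k, rfl⟩
    exact rotationSystem.face_mem_faces _

lemma ncard_faces_rotationSystem : rotationSystem.faces.ncard = 8 := by
  have hinj : Function.Injective fun k => rotationSystem.face (representative k) := by
    intro k l h
    have key : ∀ k l, faceLabel (representative k) = faceLabel (representative l) → k = l := by
      decide +kernel
    refine key k l (faceLabel_eq ?_)
    change representative k ∈ (fun k => rotationSystem.face (representative k)) l
    rw [← h]
    exact rotationSystem.mem_face_self _
  rw [faces_rotationSystem, ← Set.image_univ, Set.ncard_image_of_injective _ hinj, Set.ncard_univ,
    Nat.card_eq_fintype_card, Fintype.card_fin]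

lemma connected_graph : graph.Connected := by
  have key : ∀ v : Fin 18, v ≠ 0 → ∃ w, w < v ∧ graph.Adj w v := by decide +kernel
  have h0 : ∀ v, graph.Reachable 0 v := by
    intro v
    induction v using WellFoundedLT.induction with
    | ind v ih =>
      by_cases hv : v = 0
      · rw [hv]
      · obtain ⟨w, hw, hwv⟩ := key v hv
        exact (ih w hw).trans hwv.reachable
  exact ⟨fun u v => (h0 u).symm.trans (h0 v)⟩

/-- The outerplanar embedding of the graph. -/
def embedding : OuterplanarEmbedding graph where
  toRotationSystem := rotationSystem
  planar := by
    refine ⟨connected_graph, ?_⟩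
    rw [ncard_faces_rotationSystem, natCard_edgeSet, Nat.card_eq_fintype_card, Fintype.card_fin]
  outer := rotationSystem.face (toLeaf 0)
  outer_mem := rotationSystem.face_mem_faces _
  outer_spanning v := by
    have key : ∀ v : Fin 18, ∃ i, hex i = v ∨ tip i = v ∨ leaf i = v := by decide +kernel
    obtain ⟨i, rfl | rfl | rfl⟩ := key v
    · refine ⟨toLeaf i, ?_, rfl⟩
      rw [← face_toLeaf i]
      exact rotationSystem.mem_face_self _
    · refine ⟨down i, ?_, rfl⟩
      rw [← face_toLeaf i, ← face_down]
      exact rotationSystem.mem_face_self _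
    · refine ⟨fromLeaf i, ?_, rfl⟩
      rw [← face_toLeaf i, ← face_fromLeaf]
      exact rotationSystem.mem_face_self _

lemma face_fwd_zero : rotationSystem.face (fwd 0) = Set.range fwd := by
  ext d
  constructor
  · intro h
    have key : ∀ d, faceLabel d = faceLabel (fwd 0) → ∃ i, fwd i = d := by decide +kernel
    exact key d (faceLabel_eq h)
  · rintro ⟨i, rfl⟩
    rw [← face_fwd i]
    exact rotationSystem.mem_face_self _

instance : DecidablePred (IsOutgoing digraph) := fun d =>
  inferInstanceAs (Decidable (digraph.Adj d.fst d.snd))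

lemma modality_hex (i : Fin 6) : rotationSystem.modality (hex i) = 4 := by
  unfold RotationSystem.modality
  have : {d : graph.Dart | d.fst = hex i ∧
      ¬ (IsOutgoing digraph d ↔ IsOutgoing digraph (rotationSystem.rot d))} =
      (Finset.univ.filter fun d : graph.Dart => d.fst = hex i ∧
      ¬ (IsOutgoing digraph d ↔ IsOutgoing digraph (rotation d)) : Finset graph.Dart) := by
    ext d
    simp [rotationSystem]
  rw [this, Set.ncard_coe_finset]
  clear this
  revert i
  decide +kernel

lemma isSwitch_fwd (i : Fin 6) : rotationSystem.IsSwitch (fwd i) := by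
  unfold RotationSystem.IsSwitch
  rw [(facePerm_rotationSystem i).1]
  revert i
  decide +kernel

end Hexagon

theorem mainTheorem4 :
    ∃ (n : ℕ) (G : Digraph (Fin n)),
      -- no loops and no 2-cycles
      (∀ u v, G.Adj u v → ¬ G.Adj v u) ∧
      (∃ E : OuterplanarEmbedding G.toSimpleGraphInclusive,
        -- the outerplanar embedding is unique
        (∀ E' : OuterplanarEmbedding G.toSimpleGraphInclusive, E.EqUpToReflection E') ∧
        -- an inner face of degree 6, all of whose vertices are 4-modal and switches of the face
        (∃ f ∈ E.faces, f ≠ E.outer ∧ f.ncard = 6 ∧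
          ∀ d ∈ f, E.modality d.snd = 4 ∧ E.IsSwitch d)) ∧
      -- there is no outerplanar L-drawing
      ¬ ∃ Γ : LDrawing (Fin n), Γ.IsOuterplanar G := by
  refine ⟨18, Hexagon.digraph, by decide +kernel, ⟨Hexagon.embedding, ?_, ?_⟩,
    Hexagon.not_exists_isOuterplanar⟩
  · refine Hexagon.eqUpToReflection fun h => ?_
    -- The dart `up 0` has label 1, whereas the outer face has label 0.
    have := Hexagon.faceLabel_eq h
    revert this
    decide +kernel
  · refine ⟨Hexagon.rotationSystem.face (Hexagon.fwd 0),
      Hexagon.rotationSystem.face_mem_faces _, fun h => ?_, ?_, ?_⟩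
    · have h1 : Hexagon.fwd 0 ∈ Hexagon.rotationSystem.face (Hexagon.toLeaf 0) :=
        Set.ext_iff.1 h _ |>.1 (Hexagon.rotationSystem.mem_face_self _)
      have := Hexagon.faceLabel_eq h1
      revert this
      decide +kernel
    · rw [Hexagon.face_fwd_zero, ← Set.image_univ,
        Set.ncard_image_of_injective _ Hexagon.fwd_injective, Set.ncard_univ,
        Nat.card_eq_fintype_card, Fintype.card_fin]
    · rw [Hexagon.face_fwd_zero]
      rintro _ ⟨i, rfl⟩
      exact ⟨Hexagon.modality_hex (i + 1), Hexagon.isSwitch_fwd i⟩
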